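/- Let $\Sigma$ be a connected orientable surface without boundary (Hausdorff, second countable), with space of ends $E$ (the inverse limit, over compact $K\subset\Sigma$, of the discrete sets of connected components of $\Sigma\setminus K$), and let $E^G\subset E$ be the set of ends accumulated by genus, i.e. those ends all of whose neighbourhoods in $\Sigma$ have positive genus. For subsets $A,B\subset E$ write $A\cong B$ if there is a homeomorphism $A\to B$ carrying $A\cap E^G$ onto $B\cap E^G$. By a subsurface $S\subset\Sigma$ we mean a connected subsurface of finite type (finite genus, finitely many punctures and boundary components) that is essential: no boundary curve of $S$ bounds a disc or a once-punctured disc in $\Sigma$. The boundary may be empty, so that $\Sigma$ itself is a subsurface if it is of finite type. The subsurface $S$ is nondisplaceable if $f(S)\cap S\neq\emptyset$ for every homeomorphism $f$ of $\Sigma$. The end space is self-similar if for every decomposition $E=E_1\sqcup\dots\sqcup E_n$ ($n\ge 1$) into pairwise disjoint clopen sets there is a clopen set $D$ contained in some $E_i$ with $D\cong E$. For $x,y\in E$ write $x\preccurlyeq y$ if every clopen neighbourhood of $y$ contains a clopen set $W$ with $W\cong V$ for some clopen neighbourhood $V$ of $x$. Points $x,y$ are of the same type if $x\preccurlyeq y$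 and $y\preccurlyeq x$. Let $\mathcal M$ be the set of maximal ends, i.e. of those $x\in E$ such that $x\preccurlyeq y$ implies $y\preccurlyeq x$ for every $y\in E$. Suppose that $\Sigma$ has no nondisplaceable subsurfaces. Then the end space of $\Sigma$ is self-similar if and only if either $\mathcal M$ is a singleton, or $\mathcal M$ is (homeomorphic to) a Cantor set and any two points of $\mathcal M$ are of the same type. -/

import Mathlib

open scoped Manifold ContDiff

namespace Surf

/-! ### Surfaces -/

/-- The model plane. -/
abbrev Plane : Type := EuclideanSpace ℝ (Fin 2)

/-- `X` is a connected orientable surface without boundary: a connected, Hausdorff, second countable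
space carrying an oriented smooth atlas modelled on the plane (all transition maps have positive
Jacobian). The atlas only certifies that `X` is an orientable surface. Every notion below (subsurfaces,
homeomorphisms, ends, genus) is purely topological and does not refer to it. -/
def IsOrientableSurface (X : Type*) [TopologicalSpace X] : Prop :=
  T2Space X ∧ SecondCountableTopology X ∧ ConnectedSpace X ∧
    ∃ _ : ChartedSpace Plane X, IsManifold (𝓡 2) ∞ X ∧
      ∀ φ ∈ atlas Plane X, ∀ ψ ∈ atlas Plane X, ∀ v ∈ (φ.symm ≫ₕ ψ).source,
        0 < (fderiv ℝ (φ.symm ≫ₕ ψ) v).det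

/-! ### Finite type subsurfaces and displaceability -/

/-- The closed unit disc. -/
abbrev Disc : Type := {z : ℂ // ‖z‖ ≤ 1}

/-- The closed unit disc with its centre removed. -/
abbrev PuncturedDisc : Type := {z : ℂ // z ≠ 0 ∧ ‖z‖ ≤ 1}

section Subsurfaces

variable {X : Type*} [TopologicalSpace X]

/-- A connected subsurface (with possibly empty boundary): a nonempty connected closed subset which,
near each point of its frontier, is a half plane in some chart of `X`. Its boundary is then its
frontier in `X`. -/
def IsSubsurface (S : Set X) : Prop :=
  IsClosed S ∧ IsConnected S ∧
    ∀ x ∈ frontier S, ∃ φ : OpenPartialHomeomorph X Plane,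
      x ∈ φ.source ∧ ∀ y ∈ φ.source, y ∈ S ↔ 0 ≤ φ y 0

/-- Finite type (finite genus, finitely many boundary components, finitely many punctures): compact
up to finitely many pairwise disjoint properly embedded punctured discs. -/
def IsFiniteType (S : Set X) : Prop :=
  ∃ (n : ℕ) (p : Fin n → PuncturedDisc → X),
    (∀ i, Topology.IsClosedEmbedding (p i) ∧ Set.range (p i) ⊆ S) ∧
    (∀ i j, i ≠ j → Disjoint (Set.range (p i)) (Set.range (p j))) ∧
    IsCompact (S \ ⋃ i, p i '' {z | ‖(z : ℂ)‖ < 1})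

/-- The simple closed curve `γ` is trivial: it bounds a closed disc in `X`. -/
def BoundsDisc (γ : Set X) : Prop :=
  ∃ d : Disc → X, Topology.IsClosedEmbedding d ∧ d '' {z | ‖(z : ℂ)‖ = 1} = γ

/-- The simple closed curve `γ` is peripheral: it bounds a properly embedded once-punctured disc,
that is, it encircles a puncture of `X`. -/
def BoundsPuncturedDisc (γ : Set X) : Prop :=
  ∃ d : PuncturedDisc → X, Topology.IsClosedEmbedding d ∧ d '' {z | ‖(z : ℂ)‖ = 1} = γ

/-- Every boundary component of `S` is non-trivial and non-peripheral in `X`. -/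
def IsEssential (S : Set X) : Prop :=
  ∀ x ∈ frontier S, ¬ BoundsDisc (connectedComponentIn (frontier S) x) ∧
    ¬ BoundsPuncturedDisc (connectedComponentIn (frontier S) x)

/-- `S` is nondisplaceable: it meets its image under every homeomorphism of `X`. Orientation-reversing
homeomorphisms are allowed as well, so fewer `S` are nondisplaceable than if only orientation-preserving
ones were considered. -/
def Nondisplaceable (S : Set X) : Prop :=
  ∀ f : X ≃ₜ X, (f '' S ∩ S).Nonempty

end Subsurfaces

/-- `X` has no nondisplaceable (connected, essential, finite type) subsurface. -/
def NoNondisplaceableSubsurface (X : Type*) [TopologicalSpace X] : Prop :=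
  ∀ S : Set X, IsSubsurface S → IsFiniteType S → IsEssential S → ¬ Nondisplaceable S

/-! ### The space of ends -/

/-- The ends of `X`: compatible choices, for each compact `K`, of a connected component of the
complement of `K`. -/
def EndSpace (X : Type*) [TopologicalSpace X] : Type _ :=
  {e : TopologicalSpace.Compacts X → Set X //
    (∀ K : TopologicalSpace.Compacts X, ∃ x ∈ (K : Set X)ᶜ, e K = connectedComponentIn (K : Set X)ᶜ x) ∧
    ∀ K L, K ≤ L → e L ⊆ e K}

/-- The inverse limit topology, generated by the sets of ends lying in a given component of the
complement of a given compact set. -/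
instance (X : Type*) [TopologicalSpace X] : TopologicalSpace (EndSpace X) :=
  TopologicalSpace.generateFrom
    {s | ∃ (K : TopologicalSpace.Compacts X) (U : Set X), s = {e | e.1 K = U}}

/-- A region has positive genus if it contains a simple closed curve that does not separate it. -/
def HasGenus {X : Type*} [TopologicalSpace X] (U : Set X) : Prop :=
  ∃ γ : Circle → X, Continuous γ ∧ Function.Injective γ ∧ Set.range γ ⊆ U ∧
    IsConnected (U \ Set.range γ)

/-- The ends accumulated by genus: those all of whose neighbourhoods in `X` have positive genus. -/
def genusEnds (X : Type*) [TopologicalSpace X] : Set (EndSpace X) :=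
  {e | ∀ K, HasGenus (e.1 K)}

/-! ### Self-similarity and the order on a pair `(E, G)` -/

section Pairs

variable {E : Type*} [TopologicalSpace E]

/-- The pairs `(A, A ∩ G)` and `(B, B ∩ G)` are homeomorphic. -/
def PairHomeo (G A B : Set E) : Prop :=
  ∃ h : A ≃ₜ B, ∀ a : A, (a : E) ∈ G ↔ (h a : E) ∈ G

/-- The pair `(E, G)` is self-similar: for every decomposition of `E` into finitely many pairwise
disjoint clopen sets, one of them contains a clopen `D` with `(D, D ∩ G)` homeomorphic to
`(E, G)`. -/
def SelfSimilar (G : Set E) : Prop :=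
  ∀ (n : ℕ) (P : Fin (n + 1) → Set E), (∀ i, IsClopen (P i)) →
    (∀ i j, i ≠ j → Disjoint (P i) (P j)) → ⋃ i, P i = Set.univ →
    ∃ D : Set E, IsClopen D ∧ (∃ i, D ⊆ P i) ∧ PairHomeo G D Set.univ

/-- `x ≼ y`: every clopen neighbourhood of `y` contains a (clopen) homeomorphic copy of a clopen
neighbourhood of `x`. -/
def Below (G : Set E) (x y : E) : Prop :=
  ∀ U : Set E, IsClopen U → y ∈ U →
    ∃ V W : Set E, IsClopen V ∧ x ∈ V ∧ IsClopen W ∧ W ⊆ U ∧ PairHomeo G V W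

/-- `x ∼ y`: the points are of the same type. -/
def SameType (G : Set E) (x y : E) : Prop := Below G x y ∧ Below G y x

/-- The set of maximal points. -/
def maximalPoints (G : Set E) : Set E := {x | ∀ y, Below G x y → Below G y x}

/-- A subset is a Cantor set if it is homeomorphic to the Cantor space `2^ℕ`. -/
def IsCantorSet (A : Set E) : Prop := Nonempty (A ≃ₜ (ℕ → Bool))

end Pairs

end Surf

set_option maxSynthPendingDepth 3

/-! ### Invariance of domain in the plane, from a winding number argument. -/

namespace Surf
open Set Metric

/-! The topology of the surface enters only through a covering property of the pair (ends, genus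
ends), `exists_homeo_cover_of_noNondisplaceable`: if there are at least three ends and each end is
given a neighbourhood, then the end space is `C ∪ h(C')`, where `h` is a homeomorphism of the pair
and `C`, `C'` each lie in one of the given neighbourhoods. To obtain it, take a large connected
compact set with half-plane boundary and fill in its relatively compact and punctured-disc
complementary regions. The result is of finite type, and three separated ends make it essential.
When `f` displaces this `S`, one complementary component of `S` and the `f`-image of one such
component cover the surface. Sard's theorem supplies the compact set; invariance of domain makes
interiors of embedded discs open.

The remainder concerns compact, totally disconnected, second countable pairs (`selfSimilar_iff`). In
a self-similar pair, compactness gives a universal point, one whose every clopen neighbourhood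
contains a copy of the whole space. The maximal points are then exactly the universal points: they
form a closed set of mutually equivalent points, and as soon as there are two, copying them into
small neighbourhoods shows that none is isolated. Brouwer's characterization yields a Cantor set.

Conversely, every point lies below a maximal one (`exists_maximal_above`). If infinitely many
equivalent points are maximal, some piece of a finite decomposition contains two of them; a small
`C` is copied near one, and its complement, moved by `h⁻¹` into the small set `C'`, near the other.
If `x` is the only maximal point, the covering property embeds the complement of any clopen
neighbourhood `A` of `x` into `A`. Repeating this gives disjoint copies of the complement converging
to `x`, and shifting them along the sequence identifies the whole space with `A`. -/

theorem exists_eq_zero_of_norm_sub_lt {g : ℂ → ℂ} (hg : Continuous g)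
    (h : ∀ z : ℂ, ‖z‖ = 1 → ‖g z - z‖ < 1) : ∃ z, g z = 0 := by
  by_contra! h0
  -- A zero-free `g` has a continuous logarithm `F` on the plane. On the unit circle `g z / z` stays
  -- within 1 of 1 and so has a principal logarithm; the difference of the two would be a
  -- continuous, `2π`-periodic branch of the argument.
  obtain ⟨F, ⟨-, hF⟩, -⟩ := Complex.isCoveringMapOn_exp.existsUnique_continuousMap_lifts
    (A := ℂ) ⟨g, hg⟩ (a₀ := 0) (e₀ := Complex.log (g 0)) (Complex.exp_log (h0 0)) h0
  have hF' : ∀ z, Complex.exp (F z) = g z := fun z => congrFun hF z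
  have hnorm : ∀ s : ℝ, ‖Complex.exp (s * Complex.I)‖ = 1 := Complex.norm_exp_ofReal_mul_I
  let w : ℝ → ℂ := fun s => g (Complex.exp (s * Complex.I)) / Complex.exp (s * Complex.I)
  have hw : ∀ s, w s ∈ Complex.slitPlane := by
    intro s
    have h1 : w s = 1 + (w s - 1) := by ring
    rw [h1]
    apply Complex.mem_slitPlane_of_norm_lt_one
    have h2 : w s - 1 = (g (Complex.exp (s * Complex.I)) - Complex.exp (s * Complex.I)) /
        Complex.exp (s * Complex.I) := by
      simp only [w]; rw [sub_div, div_self (Complex.exp_ne_zero _)]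
    rw [h2, norm_div, hnorm, div_one]
    exact h _ (hnorm s)
  have hwc : Continuous w :=
    Continuous.div (by fun_prop) (by fun_prop) fun s => Complex.exp_ne_zero _
  let l : ℝ → ℂ := fun s => F (Complex.exp (s * Complex.I)) - Complex.log (w s)
  have hl : Continuous l := Continuous.sub (by fun_prop) (hwc.clog hw)
  have hle : ∀ s, Complex.exp (l s) = Complex.exp (s * Complex.I) := by
    intro s
    have hws : w s ≠ 0 := Complex.slitPlane_ne_zero (hw s)
    simp only [l, Complex.exp_sub, hF', Complex.exp_log hws]
    simp only [w]
    have := h0 (Complex.exp (s * Complex.I))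
    field_simp
  have hl0 : Complex.exp (l 0) = 1 := by simpa using hle 0
  have heq : l = fun s : ℝ => l 0 + s * Complex.I := by
    refine Complex.isCoveringMap_exp.eq_of_comp_eq hl (by fun_prop) ?_ 0 (by simp)
    funext s
    apply Subtype.ext
    simp [hle, Complex.exp_add]
  have h1 := congrFun heq (2 * Real.pi)
  have h2 : l (2 * Real.pi) = l 0 := by
    simp only [l, w]
    push_cast
    simp [Complex.exp_two_pi_mul_I]
  rw [h2] at h1
  have := Real.pi_ne_zero
  simp [Complex.ext_iff] at h1

theorem exists_mem_closedBall_eq_zero_of_norm_sub_lt {g : ℂ → ℂ}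
    (hg : ContinuousOn g (closedBall 0 1))
    (h : ∀ z : ℂ, ‖z‖ = 1 → ‖g z - z‖ < 1) : ∃ z ∈ closedBall (0 : ℂ) 1, g z = 0 := by
  -- The radial retraction onto the closed disc fixes the unit circle and extends `g` to the plane.
  let r : ℂ → ℂ := fun z => (max 1 ‖z‖)⁻¹ • z
  have hpos : ∀ z : ℂ, 0 < max 1 ‖z‖ := fun z => lt_of_lt_of_le one_pos (le_max_left _ _)
  have hr : Continuous r := by
    refine Continuous.fun_smul ?_ continuous_id
    exact Continuous.inv₀ (by fun_prop) fun z => (hpos z).ne'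
  have hmem : ∀ z, r z ∈ closedBall (0 : ℂ) 1 := by
    intro z
    rw [mem_closedBall_zero_iff, norm_smul, norm_inv, Real.norm_of_nonneg (hpos z).le,
      inv_mul_le_one₀ (hpos z)]
    exact le_max_right _ _
  obtain ⟨z, hz⟩ := exists_eq_zero_of_norm_sub_lt (g := g ∘ r)
    (hg.comp_continuous hr hmem) (fun z hz => by simpa [r, hz] using h z hz)
  exact ⟨r z, hmem z, hz⟩

/-- Invariance of domain in the plane. -/
theorem image_closedBall_mem_nhds {d : ℂ → ℂ} (hd : ContinuousOn d (closedBall 0 1))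
    (hinj : InjOn d (closedBall 0 1)) : d '' closedBall 0 1 ∈ nhds (d 0) := by
  have hKc : IsCompact (d '' closedBall 0 1) := (isCompact_closedBall 0 1).image_of_continuousOn hd
  -- Tietze extends the inverse of `d` to the plane. If `d 0` were not interior to the image, `F`
  -- could be perturbed to lose its zero on the image while staying close to the inverse at the
  -- boundary.
  obtain ⟨F, hF⟩ : ∃ F : C(ℂ, ℂ), ∀ z ∈ closedBall (0 : ℂ) 1, F (d z) = z := by
    have he : Topology.IsClosedEmbedding ((closedBall (0 : ℂ) 1).domRestrict d) :=
      Continuous.isClosedEmbedding (continuousOn_iff_continuous_domRestrict.1 hd)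
        (injOn_iff_injective.1 hinj)
    obtain ⟨F, hF⟩ := ContinuousMap.exists_extension' he
      (⟨Subtype.val, continuous_subtype_val⟩ : C(closedBall (0 : ℂ) 1, ℂ))
    exact ⟨F, fun z hz => congrFun hF ⟨z, hz⟩⟩
  set K := d '' closedBall 0 1 with hK
  have h0mem : (0 : ℂ) ∈ closedBall (0 : ℂ) 1 := by simp
  obtain ⟨r, hr, hFr⟩ : ∃ r > 0, ∀ y, dist y (d 0) < 3 * r → ‖F y‖ < 1 / 4 := by
    have := Metric.continuous_iff.1 F.continuous (d 0) (1 / 4) (by norm_num)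
    obtain ⟨δ, hδ, h⟩ := this
    refine ⟨δ / 3, by positivity, fun y hy => ?_⟩
    have := h y (by linarith)
    rwa [hF 0 h0mem, dist_zero_right] at this
  by_contra hnot
  obtain ⟨q, hq, hqK⟩ : ∃ q, dist q (d 0) < r ∧ q ∉ K := by
    by_contra! hcon
    exact hnot (Filter.mem_of_superset (Metric.ball_mem_nhds _ hr) fun y hy => hcon y hy)
  have hKB : IsCompact (K \ ball q r) := hKc.diff isOpen_ball
  obtain ⟨δ, hδ, hδ4, hFδ⟩ : ∃ δ > 0, δ ≤ 1 / 4 ∧ ∀ y ∈ K \ ball q r, δ ≤ ‖F y‖ := by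
    obtain ⟨δ, hδ, h⟩ := hKB.exists_forall_le' (f := fun y => ‖F y‖) (a := 0)
      (F.continuous.norm.continuousOn) (by
        rintro y ⟨⟨z, hz, rfl⟩, hy⟩
        rw [hF z hz, norm_pos_iff]
        rintro rfl
        exact hy (by rwa [mem_ball, dist_comm]))
    exact ⟨min δ (1 / 4), by positivity, min_le_right _ _, fun y hy => (min_le_left _ _).trans (h y hy)⟩
  obtain ⟨P₀, hP₀, hPF, -⟩ := Continuous.exists_contDiff_approx (1 : ℕ∞) F.continuous
    (continuous_const (y := δ / 2)) (fun _ => by positivity)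
  -- A smooth image of a circle has dense complement, so a small translation removes all zeros on
  -- the sphere around `q`.
  obtain ⟨c, hcm, hcδ⟩ : ∃ c ∈ (range (P₀ ∘ circleMap q r))ᶜ, dist 0 c < δ / 2 := by
    have hdense : Dense (range (P₀ ∘ circleMap q r))ᶜ := by
      apply ContDiff.dense_compl_range_of_finrank_lt_finrank
      · exact ContDiff.comp (by exact_mod_cast hP₀) (contDiff_circleMap q r)
      · simp [Complex.finrank_real_complex]
    exact hdense.exists_dist_lt 0 (by positivity)
  let P : ℂ → ℂ := fun y => P₀ y - c
  have hPF' : ∀ y, ‖P y - F y‖ < δ := by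
    intro y
    have h1 := hPF y
    rw [dist_eq_norm] at h1
    rw [dist_zero_left] at hcδ
    calc ‖P y - F y‖ = ‖(P₀ y - F y) - c‖ := by simp only [P]; ring_nf
      _ ≤ ‖P₀ y - F y‖ + ‖c‖ := norm_sub_le _ _
      _ < δ := by linarith
  have hPc : Continuous P := hP₀.continuous.sub continuous_const
  have hPs : ∀ y ∈ sphere q r, P y ≠ 0 := by
    intro y hy h
    rw [← abs_of_pos hr, ← range_circleMap] at hy
    obtain ⟨θ, rfl⟩ := hy
    exact hcm ⟨θ, by simpa [P, sub_eq_zero] using h⟩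
  -- Since `q` is missed by the image, the part of the image inside the ball can be pushed radially
  -- onto the sphere, where `P` does not vanish.
  let ρ : ℂ → ℂ := fun y => q + (max r ‖y - q‖ / ‖y - q‖) • (y - q)
  have hρ1 : ∀ y, r ≤ ‖y - q‖ → ρ y = y := by
    intro y hy
    have : ‖y - q‖ ≠ 0 := by linarith
    simp only [ρ, max_eq_right hy, div_self this, one_smul, add_sub_cancel]
  have hρ2 : ∀ y, y ≠ q → ‖y - q‖ ≤ r → ρ y ∈ sphere q r := by
    intro y hyq hy
    have : ‖y - q‖ ≠ 0 := by rwa [norm_ne_zero_iff, sub_ne_zero]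
    simp [ρ, max_eq_left hy, abs_of_pos hr, div_mul_cancel₀ _ this]
  have hneq : ∀ z ∈ closedBall (0 : ℂ) 1, d z ≠ q := fun z hz h => hqK ⟨z, hz, h⟩
  have hgc : ContinuousOn (fun z => P (ρ (d z))) (closedBall 0 1) := by
    apply hPc.comp_continuousOn
    apply ContinuousOn.add continuousOn_const
    apply ContinuousOn.fun_smul
    · apply ContinuousOn.div
      · exact continuousOn_const.sup (hd.sub continuousOn_const).norm
      · exact (hd.sub continuousOn_const).norm
      · intro z hz
        rw [norm_ne_zero_iff, sub_ne_zero]; exact hneq z hz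
    · exact hd.sub continuousOn_const
  obtain ⟨z, hz, h0⟩ := exists_mem_closedBall_eq_zero_of_norm_sub_lt hgc (by
    intro z hz
    have hzm : z ∈ closedBall (0 : ℂ) 1 := by simp [hz]
    rcases le_total r ‖d z - q‖ with h | h
    · rw [hρ1 _ h]
      have := hPF' (d z)
      rw [hF z hzm] at this
      linarith
    · have h1 := hρ2 _ (hneq z hzm) h
      have hclose : ∀ y, ‖y - q‖ ≤ r → ‖F y‖ < 1 / 4 := by
        intro y hy
        apply hFr
        calc dist y (d 0) ≤ dist y q + dist q (d 0) := dist_triangle _ _ _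
          _ < 3 * r := by rw [dist_eq_norm]; linarith
      have h2 := hclose (ρ (d z)) (by rw [← dist_eq_norm]; exact h1.le)
      have h3 := hclose _ h
      rw [hF z hzm, hz] at h3
      norm_num at h3)
  rcases le_or_gt r ‖d z - q‖ with h | h
  · rw [hρ1 _ h] at h0
    have h1 := hPF' (d z)
    have h2 := hFδ (d z) ⟨⟨z, hz, rfl⟩, by simpa [dist_eq_norm] using h⟩
    rw [h0, zero_sub, norm_neg] at h1
    linarith
  · exact hPs _ (hρ2 _ (hneq z hz) h.le) h0

theorem isOpen_image_of_continuousOn_injOn {X : Type*} [TopologicalSpace X] [ChartedSpace Plane X]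
    {f : ℂ → X} {U : Set ℂ} (hU : IsOpen U) (hf : ContinuousOn f U) (hinj : InjOn f U) :
    IsOpen (f '' U) := by
  rw [isOpen_iff_mem_nhds]
  rintro _ ⟨z, hz, rfl⟩
  let e : OpenPartialHomeomorph X ℂ := (chartAt Plane (f z)).transHomeomorph
    Complex.orthonormalBasisOneI.repr.symm.toHomeomorph
  have hez : f z ∈ e.source := by simp [e]
  obtain ⟨r, hr, hrU⟩ : ∃ r > 0, closedBall z r ⊆ U ∩ f ⁻¹' e.source :=
    Metric.nhds_basis_closedBall.mem_iff.1 (Filter.inter_mem (hU.mem_nhds hz)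
      ((hf.continuousAt (hU.mem_nhds hz)).preimage_mem_nhds (e.open_source.mem_nhds hez)))
  let s : ℂ → ℂ := fun w => z + r * w
  have hs : MapsTo s (closedBall 0 1) (closedBall z r) := by
    intro w hw
    simp only [mem_closedBall, dist_zero_right] at hw
    simp only [s, mem_closedBall, dist_self_add_left, norm_mul, Complex.norm_real,
      Real.norm_of_nonneg hr.le]
    nlinarith
  have hsinj : Function.Injective s := by
    intro a b hab
    simpa [s, hr.ne'] using hab
  have hsc : Continuous s := by fun_prop
  have key := image_closedBall_mem_nhds (d := fun w => e (f (s w)))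
    (e.continuousOn.comp ((hf.mono (hrU.trans inter_subset_left)).comp hsc.continuousOn hs)
      fun w hw => (hrU (hs hw)).2)
    (fun a ha b hb hab => hsinj (hinj (hrU (hs ha)).1 (hrU (hs hb)).1
      (e.injOn (hrU (hs ha)).2 (hrU (hs hb)).2 hab)))
  have hs0 : s 0 = z := by simp [s]
  simp only [hs0] at key
  have h2 := Filter.inter_mem ((e.continuousAt hez).preimage_mem_nhds key)
    (e.open_source.mem_nhds hez)
  refine Filter.mem_of_superset h2 ?_
  rintro x ⟨⟨w, hw, hx⟩, hxs⟩
  exact ⟨s w, (hrU (hs hw)).1, e.injOn (hrU (hs hw)).2 hxs hx⟩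

end Surf

/-! ### Sard's theorem for real functions of two variables. -/

namespace Surf
open Set Metric MeasureTheory
open scoped NNReal ENNReal

section Sard

variable {E : Type*} [NormedAddCommGroup E] [NormedSpace ℝ E]

theorem norm_sub_le_of_hasFDerivAt_segment {F : Type*} [NormedAddCommGroup F] [NormedSpace ℝ F]
    {f : E → F} {f' : E → E →L[ℝ] F} {C : ℝ} {x y : E}
    (hf : ∀ w ∈ segment ℝ x y, HasFDerivAt f (f' w) w) (hC : ∀ w ∈ segment ℝ x y, ‖f' w‖ ≤ C) :
    ‖f y - f x‖ ≤ C * ‖y - x‖ :=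
  Convex.norm_image_sub_le_of_norm_hasFDerivWithin_le
    (fun w hw => (hf w hw).hasFDerivWithinAt) hC (convex_segment x y)
    (left_mem_segment ℝ x y) (right_mem_segment ℝ x y)

theorem hasFDerivAt_of_contDiffOn {F : Type*} [NormedAddCommGroup F] [NormedSpace ℝ F]
    {h : E → F} {U : Set E} (hU : IsOpen U) (hh : ContDiffOn ℝ ∞ h U) {y : E} (hy : y ∈ U) :
    HasFDerivAt h (fderiv ℝ h y) y :=
  ((hh.contDiffAt (hU.mem_nhds hy)).differentiableAt (by simp)).hasFDerivAt

theorem norm_sub_le_of_mem_segment {x y w : E} (hw : w ∈ segment ℝ x y) : ‖w - x‖ ≤ ‖y - x‖ := by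
  rw [segment_eq_image'] at hw
  obtain ⟨t, ht, rfl⟩ := hw
  rw [add_sub_cancel_left, norm_smul, Real.norm_of_nonneg ht.1]
  exact mul_le_of_le_one_left (norm_nonneg _) ht.2

theorem holderOnWith_of_norm_sub_le {E : Type*} [SeminormedAddCommGroup E] {f : E → ℝ} {s : Set E} {C : ℝ≥0} {n : ℕ}
    (h : ∀ x ∈ s, ∀ y ∈ s, ‖f y - f x‖ ≤ C * ‖y - x‖ ^ n) : HolderOnWith C n f s := by
  intro x hx y hy
  have := h y hy x hx
  rw [← dist_eq_norm, ← dist_eq_norm] at this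
  rw [edist_dist, edist_dist, NNReal.coe_natCast, ENNReal.rpow_natCast,
    ← ENNReal.ofReal_pow dist_nonneg, ← ENNReal.ofReal_coe_nnreal, ← ENNReal.ofReal_mul (by positivity : (0 : ℝ) ≤ C)]
  exact ENNReal.ofReal_le_ofReal this

variable [FiniteDimensional ℝ E]

/-- On the critical set `Z` the function is Hölder of exponent 2, and where the Hessian vanishes as
well, of exponent 3. The first part of `Z`, with nonzero Hessian, is null in dimension 2; the second
is null in dimension 3 because the space has dimension 2. Both images are therefore null in
dimension 1. -/
theorem volume_image_critical_eq_zero_local [MeasurableSpace E] [BorelSpace E]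
    (hE : Module.finrank ℝ E = 2) {f : E → ℝ} {g : E → E →L[ℝ] ℝ}
    {H : E → E →L[ℝ] E →L[ℝ] ℝ} {B : Set E} (hBc : IsClosed B) (hB : Convex ℝ B) {C : ℝ≥0}
    (hf : ∀ x ∈ B, HasFDerivAt f (g x) x) (hg : ∀ x ∈ B, HasFDerivAt g (H x) x)
    (hH : ∀ x ∈ B, ‖H x‖ ≤ C) (hHL : ∀ x ∈ B, ∀ y ∈ B, ‖H y - H x‖ ≤ C * ‖y - x‖) :
    volume (f '' {x ∈ B | g x = 0}) = 0 := by
  set Z := {x ∈ B | g x = 0} with hZ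
  set Z₂ := {x ∈ Z | H x = 0} with hZ₂
  have hseg : ∀ x ∈ B, ∀ y ∈ B, segment ℝ x y ⊆ B := fun x hx y hy => hB.segment_subset hx hy
  have hol2 : HolderOnWith C (2 : ℕ) f Z := holderOnWith_of_norm_sub_le (by
    rintro x ⟨hx, hx0⟩ y ⟨hy, -⟩
    rw [pow_two, ← mul_assoc]
    refine norm_sub_le_of_hasFDerivAt_segment (fun w hw => hf w (hseg x hx y hy hw)) fun w hw => ?_
    have hw' := (hB.segment_subset hx (hseg x hx y hy hw))
    have h1 := norm_sub_le_of_hasFDerivAt_segment (f := g) (fun v hv => hg v (hw' hv))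
      (fun v hv => hH v (hw' hv))
    rw [hx0, sub_zero] at h1
    exact h1.trans (mul_le_mul_of_nonneg_left (norm_sub_le_of_mem_segment hw) C.2))
  have hol3 : HolderOnWith C (3 : ℕ) f Z₂ := holderOnWith_of_norm_sub_le (by
    rintro x ⟨⟨hx, hx0⟩, hxH⟩ y ⟨⟨hy, -⟩, -⟩
    rw [pow_succ, ← mul_assoc]
    refine norm_sub_le_of_hasFDerivAt_segment (fun w hw => hf w (hseg x hx y hy hw)) fun w hw => ?_
    have hw' := (hB.segment_subset hx (hseg x hx y hy hw))
    have h1 := norm_sub_le_of_hasFDerivAt_segment (f := g) (C := C * ‖y - x‖)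
      (fun v hv => hg v (hw' hv)) (fun v hv => by
        have := hHL x hx v (hw' hv)
        rw [hxH, sub_zero] at this
        exact this.trans (mul_le_mul_of_nonneg_left ((norm_sub_le_of_mem_segment hv).trans
          (norm_sub_le_of_mem_segment hw)) C.2))
    rw [hx0, sub_zero] at h1
    rw [pow_two, ← mul_assoc]
    exact h1.trans (mul_le_mul_of_nonneg_left (norm_sub_le_of_mem_segment hw) (by positivity)))
  have hgc : ContinuousOn g B := fun x hx => (hg x hx).continuousAt.continuousWithinAt
  have hZc : IsClosed Z := by
    have : Z = B ∩ g ⁻¹' {0} := by ext; simp [Z]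
    rw [this]
    exact hgc.preimage_isClosed_of_isClosed hBc isClosed_singleton
  let μ : Measure E := Measure.hausdorffMeasure (Module.finrank ℝ E : ℝ)
  have hnull : μ (Z \ Z₂) = 0 := by
    have hfr : Module.finrank ℝ (E →L[ℝ] ℝ) = Module.finrank ℝ E := by
      rw [← (LinearMap.toContinuousLinearMap (𝕜 := ℝ) (E := E) (F' := ℝ)).finrank_eq]
      exact Subspace.dual_finrank_eq
    let L : (E →L[ℝ] ℝ) ≃L[ℝ] E := ContinuousLinearEquiv.ofFinrankEq hfr
    -- The gradient is constantly zero on `Z`, so its derivative, the Hessian, vanishes at almost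
    -- every point of `Z`. The identification `L` only turns it into a self-map of `E`.
    have happ : ApproximatesLinearOn (fun x => L (g x)) (0 : E →L[ℝ] E) Z 0 := by
      rintro x ⟨-, hx⟩ y ⟨-, hy⟩
      simp [hx, hy]
    have := happ.norm_fderiv_sub_le μ hZc.measurableSet
      (fun x => (L : (E →L[ℝ] ℝ) →L[ℝ] E).comp (H x)) (fun x hx =>
        (((L : (E →L[ℝ] ℝ) →L[ℝ] E).hasFDerivAt).comp x (hg x hx.1)).hasFDerivWithinAt)
    rw [ae_restrict_iff' hZc.measurableSet] at this
    refine measure_mono_null ?_ this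
    rintro x ⟨hxZ, hx2⟩
    simp only [mem_compl_iff, mem_ofPred_eq, Classical.not_imp]
    refine ⟨hxZ, fun h => hx2 ⟨hxZ, ?_⟩⟩
    have h0 : (L : (E →L[ℝ] ℝ) →L[ℝ] E).comp (H x) = 0 := by simpa using h
    ext v w
    have h1 : L (H x v) = 0 := congrArg (fun T : E →L[ℝ] E => T v) h0
    simp [L.map_eq_zero_iff.1 h1]
  have hZ2Z : Z₂ ⊆ Z := fun x hx => hx.1
  have himg : f '' Z = f '' (Z \ Z₂) ∪ f '' Z₂ := by rw [← image_union, sdiff_union_of_subset hZ2Z]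
  rw [himg, measure_union_null_iff, ← hausdorffMeasure_real]
  constructor
  · have := (hol2.mono (sdiff_subset (t := Z₂))).hausdorffMeasure_image_le (by norm_num)
      (zero_le_one (α := ℝ))
    have h2 : ((2 : ℕ) : ℝ≥0) * (1 : ℝ) = (Module.finrank ℝ E : ℝ) := by rw [hE]; simp
    rw [h2] at this
    exact le_antisymm (this.trans (by rw [show Measure.hausdorffMeasure _ (Z \ Z₂) = 0 from hnull, mul_zero])) bot_le
  · have := hol3.hausdorffMeasure_image_le (by norm_num) (zero_le_one (α := ℝ))
    have h3 : Measure.hausdorffMeasure (((3 : ℕ) : ℝ≥0) * (1 : ℝ)) Z₂ = 0 := by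
      have : (((3 : ℕ) : ℝ≥0) * (1 : ℝ)) = ((3 : ℝ≥0) : ℝ) := by simp
      rw [this]
      apply hausdorffMeasure_of_dimH_lt
      refine (dimH_mono (subset_univ _)).trans_lt ?_
      rw [Real.dimH_univ_eq_finrank, hE]
      norm_num
    exact le_antisymm (this.trans (by rw [h3, mul_zero])) bot_le

/-- On a small closed ball, bounds on the second and third derivatives give the constants of the
local version; countably many balls suffice. -/
theorem volume_image_critical_eq_zero [MeasurableSpace E] [BorelSpace E]
    (hE : Module.finrank ℝ E = 2) {f : E → ℝ} {U : Set E} (hU : IsOpen U)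
    (hf : ContDiffOn ℝ ∞ f U) : volume (f '' {x ∈ U | fderiv ℝ f x = 0}) = 0 := by
  have hf1 : ContDiffOn ℝ ∞ (fderiv ℝ f) U := hf.fderiv_of_isOpen hU (by simp)
  have hf2 : ContDiffOn ℝ ∞ (fderiv ℝ (fderiv ℝ f)) U := hf1.fderiv_of_isOpen hU (by simp)
  have hf3 : ContDiffOn ℝ ∞ (fderiv ℝ (fderiv ℝ (fderiv ℝ f))) U :=
    hf2.fderiv_of_isOpen hU (by simp)
  have hloc : ∀ x ∈ U, ∃ t ∈ nhds x, volume (f '' ({x ∈ U | fderiv ℝ f x = 0} ∩ t)) = 0 := by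
    intro x hx
    obtain ⟨r, hr, hrU⟩ := Metric.nhds_basis_closedBall.mem_iff.1 (hU.mem_nhds hx)
    have hK := isCompact_closedBall x r
    obtain ⟨C₁, hC₁⟩ := hK.exists_bound_of_continuousOn (hf2.continuousOn.mono hrU)
    obtain ⟨C₂, hC₂⟩ := hK.exists_bound_of_continuousOn (hf3.continuousOn.mono hrU)
    let C : ℝ≥0 := Real.toNNReal (max C₁ C₂)
    refine ⟨closedBall x r, closedBall_mem_nhds x hr, ?_⟩
    have := volume_image_critical_eq_zero_local hE isClosed_closedBall (convex_closedBall x r)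
      (C := C) 
      (fun y hy => hasFDerivAt_of_contDiffOn hU hf (hrU hy))
      (fun y hy => hasFDerivAt_of_contDiffOn hU hf1 (hrU hy))
      (fun y hy => (hC₁ y hy).trans ((le_max_left _ _).trans (Real.le_coe_toNNReal _)))
      (fun y hy z hz => norm_sub_le_of_hasFDerivAt_segment
        (fun w hw => hasFDerivAt_of_contDiffOn hU hf2
          (hrU ((convex_closedBall x r).segment_subset hy hz hw)))
        (fun w hw => (hC₂ w ((convex_closedBall x r).segment_subset hy hz hw)).trans
          ((le_max_right _ _).trans (Real.le_coe_toNNReal _))))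
    refine measure_mono_null (image_mono ?_) this
    rintro y ⟨⟨-, hy⟩, hyB⟩
    exact ⟨hyB, hy⟩
  choose! t ht hvol using hloc
  obtain ⟨c, hcU, hcc, hcov⟩ := TopologicalSpace.countable_cover_nhdsWithin
    (s := U) (f := t) (fun x hx => mem_nhdsWithin_of_mem_nhds (ht x hx))
  have : f '' {x ∈ U | fderiv ℝ f x = 0} ⊆
      ⋃ x ∈ c, f '' ({x ∈ U | fderiv ℝ f x = 0} ∩ t x) := by
    rintro _ ⟨y, hy, rfl⟩
    obtain ⟨x, hx, hyx⟩ := mem_iUnion₂.1 (hcov hy.1)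
    exact mem_iUnion₂.2 ⟨x, hx, y, ⟨hy, hyx⟩, rfl⟩
  exact measure_mono_null this ((measure_biUnion_null_iff hcc).2 fun x hx => hvol x (hcU hx))

end Sard

end Surf

/-! ### Compact sets with half-plane boundary. -/

namespace Surf
open Set Metric MeasureTheory

/-- `S` is a half plane in some chart near each point of its frontier. -/
def LocallyHalfPlane {X : Type*} [TopologicalSpace X] (S : Set X) : Prop :=
  ∀ x ∈ frontier S, ∃ φ : OpenPartialHomeomorph X Plane,
      x ∈ φ.source ∧ ∀ y ∈ φ.source, y ∈ S ↔ 0 ≤ φ y 0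

/-- A function with a nonzero derivative, shifted by a constant, is the first coordinate of a
chart. -/
theorem exists_chart_of_fderiv_ne_zero {F : Plane → ℝ} {U : Set Plane} (hU : IsOpen U)
    (hF : ContDiffOn ℝ ∞ F U) {v : Plane} (hv : v ∈ U) (h : fderiv ℝ F v ≠ 0) (c : ℝ) :
    ∃ φ : OpenPartialHomeomorph Plane Plane, v ∈ φ.source ∧ ∀ y ∈ φ.source, φ y 0 = F y - c := by
  have hs : HasStrictFDerivAt F (fderiv ℝ F v) v :=
    (hF.contDiffAt (hU.mem_nhds hv)).hasStrictFDerivAt (by simp)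
  have hr : (fderiv ℝ F v).range = ⊤ :=
    LinearMap.range_eq_top.2 (LinearMap.surjective fun h0 =>
      h (ContinuousLinearMap.coe_injective h0))
  -- The implicit function theorem straightens `F` to the first factor of `ℝ × ker`, and the kernel
  -- is a line.
  let e := hs.implicitToOpenPartialHomeomorph F _ hr
  have hk : Module.finrank ℝ (fderiv ℝ F v).ker = Module.finrank ℝ ℝ := by
    have := LinearMap.finrank_range_add_finrank_ker (fderiv ℝ F v).toLinearMap
    rw [hr, finrank_top, finrank_euclideanSpace_fin, Module.finrank_self] at this
    rw [Module.finrank_self]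
    omega
  let m : (fderiv ℝ F v).ker ≃L[ℝ] ℝ := ContinuousLinearEquiv.ofFinrankEq hk
  let h : ℝ × (fderiv ℝ F v).ker ≃ₜ Plane :=
    ((Homeomorph.addRight (-c)).prodCongr m.toHomeomorph).trans
      ((Homeomorph.finTwoArrow).symm.trans (EuclideanSpace.equiv (Fin 2) ℝ).symm.toHomeomorph)
  refine ⟨e.transHomeomorph h, ?_, ?_⟩
  · exact hs.mem_implicitToOpenPartialHomeomorph_source hr
  · intro y hy
    simp [h, e, sub_eq_add_neg]

/-- Every compact set lies in a compact set that is locally a half plane along its frontier. -/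
theorem exists_isCompact_locallyHalfPlane {X : Type*} [TopologicalSpace X] [T2Space X]
    [SecondCountableTopology X] [ChartedSpace Plane X] [IsManifold (𝓡 2) ∞ X] {L : Set X}
    (hL : IsCompact L) : ∃ K, IsCompact K ∧ L ⊆ K ∧ LocallyHalfPlane K := by
  have : LocallyCompactSpace X := ChartedSpace.locallyCompactSpace Plane X
  obtain ⟨L', hL', hLL'⟩ := exists_compact_superset hL
  obtain ⟨f, hf, hf01, hf0, hf1⟩ := exists_contMDiff_zero_iff_one_iff_of_isClosed (𝓡 2) (n := ⊤)
    (s := (interior L')ᶜ) (t := L) isOpen_interior.isClosed_compl hL.isClosed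
    (disjoint_compl_left_iff_subset.2 hLL')
  have hfe : ∀ x : X, ContDiffOn ℝ ∞ (f ∘ (chartAt Plane x).symm) (chartAt Plane x).target := by
    intro x
    rw [← contMDiffOn_iff_contDiffOn]
    exact hf.comp_contMDiffOn (contMDiffOn_chart_symm (x := x))
  obtain ⟨s, hsc, hs⟩ := TopologicalSpace.countable_cover_nhds
    fun x : X => (chartAt Plane x).open_source.mem_nhds (mem_chart_source Plane x)
  let V : Set ℝ := ⋃ x ∈ s, (f ∘ (chartAt Plane x).symm) ''
    {v ∈ (chartAt Plane x).target | fderiv ℝ (f ∘ (chartAt Plane x).symm) v = 0}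
  have hV : volume V = 0 := (measure_biUnion_null_iff hsc).2 fun x _ =>
    volume_image_critical_eq_zero (finrank_euclideanSpace_fin) (chartAt Plane x).open_target (hfe x)
  -- A value of the bump function that is regular in all of countably many charts; its superlevel
  -- set is the required compact set.
  obtain ⟨c, ⟨hc0, hc1⟩, hcV⟩ : (Ioo (0 : ℝ) 1 \ V).Nonempty := by
    rw [nonempty_iff_ne_empty]
    intro h
    have h1 := measure_sdiff_null (μ := volume) (s := Ioo (0 : ℝ) 1) hV
    rw [h, measure_empty, Real.volume_Ioo] at h1
    norm_num at h1
  have hKc : IsClosed {x | c ≤ f x} := isClosed_le continuous_const hf.continuous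
  refine ⟨{x | c ≤ f x}, hL'.of_isClosed_subset hKc ?_, ?_, ?_⟩
  · intro x hx
    by_contra hx'
    have h0 := (hf0 x).1 (fun h => hx' (interior_subset h))
    simp only [mem_ofPred_eq, h0] at hx
    linarith
  · intro x hx
    rw [mem_ofPred_eq, (hf1 x).1 hx]
    exact hc1.le
  · intro x hx
    have hxc : c = f x := frontier_le_subset_eq continuous_const hf.continuous hx
    obtain ⟨y, hys, hxy⟩ := mem_iUnion₂.1 (hs.symm.subset (mem_univ x))
    have hne : fderiv ℝ (f ∘ (chartAt Plane y).symm) (chartAt Plane y x) ≠ 0 := by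
      intro h0
      refine hcV (mem_iUnion₂.2 ⟨y, hys, chartAt Plane y x,
        ⟨(chartAt Plane y).map_source hxy, h0⟩, ?_⟩)
      simp [(chartAt Plane y).left_inv hxy, hxc]
    obtain ⟨ψ, hψ, hψF⟩ := exists_chart_of_fderiv_ne_zero (chartAt Plane y).open_target (hfe y)
      ((chartAt Plane y).map_source hxy) hne c
    refine ⟨(chartAt Plane y).trans ψ, by simp [hxy, hψ], ?_⟩
    intro z hz
    simp only [OpenPartialHomeomorph.trans_source, mem_inter_iff, mem_preimage] at hz
    simp [hψF _ hz.2, (chartAt Plane y).left_inv hz.1]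

end Surf

/-! ### Collars of the boundary. -/

namespace Surf
open Set Metric

section HalfPlane

variable {X : Type*} [TopologicalSpace X] {S K : Set X} {x : X}

theorem LocallyHalfPlane.exists_chart (hS : LocallyHalfPlane S) (hx : x ∈ frontier S)
    {N : Set X} (hN : N ∈ nhds x) : ∃ φ : OpenPartialHomeomorph X Plane, x ∈ φ.source ∧
      φ.source ⊆ N ∧ φ x 0 = 0 ∧ (∃ r > 0, φ.target = ball (φ x) r) ∧
      ∀ y ∈ φ.source, y ∈ S ↔ 0 ≤ φ y 0 := by
  obtain ⟨φ, hxφ, hφ⟩ := hS x hx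
  have hc : ContinuousAt (fun y => φ y 0) x :=
    (EuclideanSpace.proj (𝕜 := ℝ) (0 : Fin 2)).continuous.continuousAt.comp (φ.continuousAt hxφ)
  have hx0 : φ x 0 = 0 := by
    rcases lt_trichotomy (φ x 0) 0 with h | h | h
    · have h1 : Sᶜ ∈ nhds x := by
        filter_upwards [hc.eventually_lt_const h, φ.open_source.mem_nhds hxφ] with y hy hyφ hyS
        exact absurd ((hφ y hyφ).1 hyS) (not_le.2 hy)
      rw [← frontier_compl] at hx
      exact absurd (mem_interior_iff_mem_nhds.2 h1) hx.2
    · exact h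
    · have h1 : S ∈ nhds x := by
        filter_upwards [hc.eventually_const_lt h, φ.open_source.mem_nhds hxφ] with y hy hyφ
        exact (hφ y hyφ).2 hy.le
      exact absurd (mem_interior_iff_mem_nhds.2 h1) hx.2
  obtain ⟨r, hr, hrb⟩ : ∃ r > 0, ball (φ x) r ⊆ φ.target ∩ φ.symm ⁻¹' N := by
    apply Metric.mem_nhds_iff.1
    refine Filter.inter_mem (φ.open_target.mem_nhds (φ.map_source hxφ)) ?_
    apply (φ.continuousAt_symm (φ.map_source hxφ)).preimage_mem_nhds
    rwa [φ.left_inv hxφ]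
  let ψ := (φ.symm.restrOpen (ball (φ x) r) isOpen_ball).symm
  refine ⟨ψ, ?_, ?_, hx0, ⟨r, hr, ?_⟩, ?_⟩
  · simp [ψ, hxφ, hr]
  · rintro y hy
    simp only [ψ, OpenPartialHomeomorph.symm_source] at hy
    have h2 : φ y ∈ ball (φ x) r ∧ y ∈ φ.source := by
      simpa [ψ, and_comm] using hy
    have := (hrb h2.1).2
    rwa [mem_preimage, φ.left_inv h2.2] at this
  · simp only [ψ, OpenPartialHomeomorph.symm_target, OpenPartialHomeomorph.restrOpen_source,
      OpenPartialHomeomorph.symm_source]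
    exact inter_eq_right.2 (hrb.trans inter_subset_left)
  · intro y hy
    have h2 : φ y ∈ ball (φ x) r ∧ y ∈ φ.source := by
      simpa [ψ, and_comm] using hy
    exact hφ y h2.2

theorem isConnected_ball_inter {p : Plane} {r : ℝ} {A : Set Plane} (hA : Convex ℝ A)
    (hne : (ball p r ∩ A).Nonempty) : IsConnected (ball p r ∩ A) :=
  ⟨hne, ((convex_ball p r).inter hA).isPreconnected⟩

/-- In a round chart centred on the boundary line, the two sides and the line itself are convex,
hence connected. All later arguments use boundary charts only through this. -/
theorem LocallyHalfPlane.exists_collar (hS : LocallyHalfPlane S) (hx : x ∈ frontier S)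
    {N : Set X} (hN : N ∈ nhds x) : ∃ W ⊆ N, IsOpen W ∧ x ∈ W ∧ IsConnected (W ∩ S) ∧
      IsConnected (W \ S) ∧ IsConnected (W ∩ frontier S) ∧ IsConnected (W ∩ interior S) := by
  obtain ⟨φ, hxφ, hφN, hx0, ⟨r, hr, htar⟩, hφ⟩ := hS.exists_chart hx hN
  have hl : IsLinearMap ℝ (fun v : Plane => v 0) := ⟨fun _ _ => rfl, fun _ _ => rfl⟩
  have hlc : Continuous (fun v : Plane => v 0) := by fun_prop
  let t : ℝ → Plane := fun s => φ x + EuclideanSpace.single 0 s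
  have ht : ∀ s, |s| < r → t s ∈ ball (φ x) r := by
    intro s hs
    simpa [t] using hs
  have ht0 : ∀ s, t s 0 = s := by intro s; simp [t, hx0]
  have himg : ∀ (A : Set Plane) (B : Set X), (∀ y ∈ φ.source, y ∈ B ↔ φ y ∈ A) →
      φ.source ∩ B = φ.symm '' (ball (φ x) r ∩ A) := by
    intro A B h
    ext y
    constructor
    · rintro ⟨hy, hyB⟩
      exact ⟨φ y, ⟨htar ▸ φ.map_source hy, (h y hy).1 hyB⟩, φ.left_inv hy⟩
    · rintro ⟨v, ⟨hv, hvA⟩, rfl⟩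
      rw [← htar] at hv
      exact ⟨φ.map_target hv, (h _ (φ.map_target hv)).2 (by rwa [φ.right_inv hv])⟩
  have hcon : ∀ (A : Set Plane) (B : Set X), (∀ y ∈ φ.source, y ∈ B ↔ φ y ∈ A) → Convex ℝ A →
      ∀ s, |s| < r → t s ∈ A → IsConnected (φ.source ∩ B) := by
    intro A B h hA s hs hsA
    rw [himg A B h]
    refine (isConnected_ball_inter hA ⟨t s, ht s hs, hsA⟩).image _ (φ.continuousOn_symm.mono ?_)
    rw [htar]; exact inter_subset_left
  have hc : ∀ y ∈ φ.source, ContinuousAt (fun y => φ y 0) y := fun y hy =>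
    (EuclideanSpace.proj (𝕜 := ℝ) (0 : Fin 2)).continuous.continuousAt.comp (φ.continuousAt hy)
  have hint : ∀ y ∈ φ.source, y ∈ interior S ↔ 0 < φ y 0 := by
    intro y hy
    constructor
    · intro h
      refine lt_of_le_of_ne ((hφ y hy).1 (interior_subset h)) fun h0 => ?_
      -- At an interior point with first coordinate zero, a small move to negative first coordinate
      -- would remain in `S`.
      have hq : ContinuousAt (fun s : ℝ => φ y + s • EuclideanSpace.single 0 (1 : ℝ)) 0 := by
        fun_prop
      have hev : ∀ᶠ s in nhds (0 : ℝ), φ.symm (φ y + s • EuclideanSpace.single 0 (1 : ℝ)) ∈ S ∧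
          φ y + s • EuclideanSpace.single 0 (1 : ℝ) ∈ φ.target := by
        have h2 : φ.target ∩ φ.symm ⁻¹' S ∈ nhds (φ y) := by
          refine Filter.inter_mem (φ.open_target.mem_nhds (φ.map_source hy)) ?_
          apply (φ.continuousAt_symm (φ.map_source hy)).preimage_mem_nhds
          rw [φ.left_inv hy]
          exact mem_interior_iff_mem_nhds.1 h
        have h3 := hq.preimage_mem_nhds (t := φ.target ∩ φ.symm ⁻¹' S) (by simpa using h2)
        filter_upwards [h3] with s hs using ⟨hs.2, hs.1⟩
      obtain ⟨s, hs, hs0⟩ := ((hev.filter_mono nhdsWithin_le_nhds).and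
        (self_mem_nhdsWithin (a := (0 : ℝ)) (s := Iio 0))).exists
      have := (hφ _ (φ.map_target hs.2)).1 hs.1
      rw [φ.right_inv hs.2] at this
      simp [← h0] at this
      exact absurd hs0 (not_lt.2 this)
    · intro h
      rw [mem_interior_iff_mem_nhds]
      filter_upwards [(hc y hy).eventually_const_lt h, φ.open_source.mem_nhds hy] with z hz hzφ
      exact (hφ z hzφ).2 hz.le
  have hfr : ∀ y ∈ φ.source, y ∈ frontier S ↔ φ y 0 = 0 := by
    intro y hy
    rw [frontier, mem_sdiff, hint y hy]
    constructor
    · rintro ⟨h1, h2⟩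
      refine le_antisymm (not_lt.1 h2) (not_lt.1 fun h => ?_)
      rw [mem_closure_iff_frequently] at h1
      apply h1
      filter_upwards [(hc y hy).eventually_lt_const h, φ.open_source.mem_nhds hy] with z hz hzφ hzS
      exact absurd ((hφ z hzφ).1 hzS) (not_le.2 hz)
    · intro h
      exact ⟨subset_closure ((hφ y hy).2 h.ge), by simp [h]⟩
  have hr2 : |r / 2| < r := by rw [abs_of_pos (by positivity)]; linarith
  have hr2' : |-(r / 2)| < r := by rw [abs_neg]; exact hr2
  refine ⟨φ.source, hφN, φ.open_source, hxφ, ?_, ?_, ?_, ?_⟩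
  · exact hcon {v | 0 ≤ v 0} S hφ (convex_halfSpace_ge hl 0) (r / 2) hr2 (by simp [ht0]; positivity)
  · exact hcon {v | v 0 < 0} Sᶜ (fun y hy => by simp [hφ y hy]) (convex_halfSpace_lt hl 0)
      (-(r / 2)) hr2' (by simp [ht0]; positivity)
  · exact hcon {v | v 0 = 0} _ hfr (convex_hyperplane hl 0) 0 (by simpa) (by simp [ht0])
  · exact hcon {v | 0 < v 0} _ hint (convex_halfSpace_gt hl 0) (r / 2) hr2
      (by simp [ht0]; positivity)

theorem LocallyHalfPlane.of_eventually_iff (hK : LocallyHalfPlane K)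
    (h : ∀ x ∈ frontier S, x ∈ frontier K ∧ ∃ W ∈ nhds x, ∀ y ∈ W, y ∈ S ↔ y ∈ K) :
    LocallyHalfPlane S := by
  intro x hx
  obtain ⟨hxK, W, hW, hWS⟩ := h x hx
  obtain ⟨φ, hxφ, hφW, -, -, hφ⟩ := hK.exists_chart hxK hW
  exact ⟨φ, hxφ, fun y hy => (hWS y (hφW hy)).trans (hφ y hy)⟩

theorem isClosed_connectedComponentIn (hc : IsClosed K) : IsClosed (connectedComponentIn K x) := by
  by_cases hx : x ∈ K
  · refine closure_subset_iff_isClosed.1 ?_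
    exact isPreconnected_connectedComponentIn.closure.subset_connectedComponentIn
      (subset_closure (mem_connectedComponentIn hx))
      (closure_minimal (connectedComponentIn_subset K x) hc)
  · rw [connectedComponentIn_eq_empty hx]
    exact isClosed_empty

/-- The inner side of a collar is connected, so near a point of its frontier the component agrees
with `K`. -/
theorem LocallyHalfPlane.component [LocallyConnectedSpace X] (hK : LocallyHalfPlane K) (hc : IsClosed K) :
    LocallyHalfPlane (connectedComponentIn K x) := by
  have hcl : IsClosed (connectedComponentIn K x) := isClosed_connectedComponentIn hc
  refine hK.of_eventually_iff fun y hy => ?_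
  have hyC : y ∈ connectedComponentIn K x := hcl.frontier_subset hy
  have hyK : y ∈ K := connectedComponentIn_subset K x hyC
  rw [connectedComponentIn_eq hyC] at hy ⊢
  have hfr : y ∈ frontier K := by
    rw [hc.frontier_eq]
    refine ⟨hyK, fun h => hy.2 ?_⟩
    exact mem_interior_iff_mem_nhds.2 (connectedComponentIn_mem_nhds (mem_interior_iff_mem_nhds.1 h))
  obtain ⟨W, -, hWo, hyW, hWK, -⟩ := hK.exists_collar hfr Filter.univ_mem
  refine ⟨hfr, W, hWo.mem_nhds hyW, fun z hz => ⟨fun h => connectedComponentIn_subset K y h,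
    fun h => ?_⟩⟩
  exact hWK.isPreconnected.subset_connectedComponentIn ⟨hyW, hyK⟩ inter_subset_right ⟨hz, h⟩

end HalfPlane

/-! ### Complementary components and their union with `K`. -/

section Components

variable {X : Type*} [TopologicalSpace X] {K : Set X} {x y : X}

/-- Otherwise the component would be closed as well as open, against connectedness of the space. -/
theorem closure_connectedComponentIn_compl_inter_nonempty [LocallyConnectedSpace X] [ConnectedSpace X]
    (hK : IsClosed K) (hne : K.Nonempty)
    (hx : x ∉ K) : (closure (connectedComponentIn Kᶜ x) ∩ K).Nonempty := by
  by_contra hcon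
  have hsub : closure (connectedComponentIn Kᶜ x) ⊆ Kᶜ := by
    intro y hy hyK
    exact hcon ⟨y, hy, hyK⟩
  have hpre : closure (connectedComponentIn Kᶜ x) ⊆ connectedComponentIn Kᶜ x :=
    isPreconnected_connectedComponentIn.closure.subset_connectedComponentIn
      (subset_closure (mem_connectedComponentIn (mem_compl hx))) hsub
  have hclopen : IsClopen (connectedComponentIn Kᶜ x) :=
    ⟨closure_subset_iff_isClosed.1 hpre, hK.isOpen_compl.connectedComponentIn⟩
  rcases isClopen_iff.1 hclopen with h | h
  · exact absurd (mem_connectedComponentIn (mem_compl hx)) (by simp [h])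
  · obtain ⟨y, hy⟩ := hne
    have hyc : y ∈ Kᶜ := connectedComponentIn_subset Kᶜ x (h.symm ▸ mem_univ y)
    exact hyc hy

theorem isConnected_union_components [LocallyConnectedSpace X] [ConnectedSpace X]
    (hK : IsClosed K) (hc : IsConnected K) (P : Set X → Prop) :
    IsConnected (K ∪ {y | y ∉ K ∧ P (connectedComponentIn Kᶜ y)}) := by
  obtain ⟨p, hp⟩ := hc.nonempty
  refine ⟨⟨p, Or.inl hp⟩, isPreconnected_of_forall p ?_⟩
  rintro y (hy | ⟨hy, hPy⟩)
  · exact ⟨K, subset_union_left, hp, hy, hc.isPreconnected⟩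
  · obtain ⟨q, hq, hqK⟩ := closure_connectedComponentIn_compl_inter_nonempty hK ⟨p, hp⟩ hy
    refine ⟨K ∪ insert q (connectedComponentIn Kᶜ y), ?_, Or.inl hp,
      Or.inr (mem_insert_of_mem _ (mem_connectedComponentIn (mem_compl hy))), ?_⟩
    · refine union_subset subset_union_left (insert_subset (Or.inl hqK) fun z hz => Or.inr ?_)
      exact ⟨connectedComponentIn_subset _ _ hz, connectedComponentIn_eq hz ▸ hPy⟩
    · refine hc.isPreconnected.union q hqK (mem_insert _ _) ?_
      exact isPreconnected_connectedComponentIn.subset_closure (subset_insert _ _)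
        (insert_subset hq subset_closure)

theorem compl_union_components (P : Set X → Prop) :
    (K ∪ {y | y ∉ K ∧ P (connectedComponentIn Kᶜ y)})ᶜ =
      {y | y ∉ K ∧ ¬ P (connectedComponentIn Kᶜ y)} := by
  ext y
  simp only [mem_compl_iff, mem_union, mem_ofPred_eq]
  tauto

theorem isClosed_union_components [LocallyConnectedSpace X] (hK : IsClosed K) (P : Set X → Prop) :
    IsClosed (K ∪ {y | y ∉ K ∧ P (connectedComponentIn Kᶜ y)}) := by
  rw [← isOpen_compl_iff, compl_union_components, isOpen_iff_mem_nhds]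
  rintro y ⟨hy, hPy⟩
  refine Filter.mem_of_superset (hK.isOpen_compl.connectedComponentIn.mem_nhds
    (mem_connectedComponentIn (mem_compl hy))) fun z hz => ?_
  exact ⟨connectedComponentIn_subset _ _ hz, connectedComponentIn_eq hz ▸ hPy⟩

theorem frontier_union_components_subset [LocallyConnectedSpace X] (hK : IsClosed K) (P : Set X → Prop) :
    frontier (K ∪ {y | y ∉ K ∧ P (connectedComponentIn Kᶜ y)}) ⊆ frontier K := by
  intro y hy
  rw [hK.frontier_eq]
  refine ⟨?_, fun h => hy.2 (interior_mono subset_union_left h)⟩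
  by_contra hyK
  refine hy.2 (mem_interior_iff_mem_nhds.2 ?_)
  have hyS := (isClosed_union_components hK P).frontier_subset hy
  refine Filter.mem_of_superset (hK.isOpen_compl.connectedComponentIn.mem_nhds
    (mem_connectedComponentIn (mem_compl hyK))) fun z hz => Or.inr ?_
  refine ⟨connectedComponentIn_subset _ _ hz, connectedComponentIn_eq hz ▸ ?_⟩
  rcases hyS with h | h
  · exact absurd h hyK
  · exact h.2

/-- The outer side of a collar lies in one complementary component. At a point that remains on the
frontier this component has not been added, so the old chart still works. -/
theorem LocallyHalfPlane.union_components [LocallyConnectedSpace X] (hS : LocallyHalfPlane K) (hK : IsClosed K)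
    (P : Set X → Prop) :
    LocallyHalfPlane (K ∪ {y | y ∉ K ∧ P (connectedComponentIn Kᶜ y)}) := by
  refine hS.of_eventually_iff fun y hy => ?_
  have hyK := frontier_union_components_subset hK P hy
  obtain ⟨W, -, hWo, hyW, -, hWK, -⟩ := hS.exists_collar hyK Filter.univ_mem
  refine ⟨hyK, W, hWo.mem_nhds hyW, fun z hz => ⟨fun h => ?_, fun h => Or.inl h⟩⟩
  by_contra hzK
  rcases h with h | ⟨-, h⟩
  · exact hzK h
  have hWc : W \ K ⊆ connectedComponentIn Kᶜ z :=
    hWK.isPreconnected.subset_connectedComponentIn ⟨hz, hzK⟩ fun w hw => hw.2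
  rw [← frontier_compl, compl_union_components] at hy
  obtain ⟨w, hwW, hwK, hw⟩ := mem_closure_iff.1 hy.1 W hWo hyW
  exact hw (connectedComponentIn_eq (hWc ⟨hwW, hwK⟩) ▸ h)

theorem connectedComponentIn_compl_union_components (P : Set X → Prop)
    (hx : x ∉ K ∪ {y | y ∉ K ∧ P (connectedComponentIn Kᶜ y)}) :
    connectedComponentIn (K ∪ {y | y ∉ K ∧ P (connectedComponentIn Kᶜ y)})ᶜ x =
      connectedComponentIn Kᶜ x := by
  refine (connectedComponentIn_mono x (compl_subset_compl.2 subset_union_left)).antisymm ?_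
  have hx' : x ∉ K ∧ ¬ P (connectedComponentIn Kᶜ x) := by
    rw [← mem_compl_iff, compl_union_components] at hx
    exact hx
  refine isPreconnected_connectedComponentIn.subset_connectedComponentIn
    (mem_connectedComponentIn hx'.1) fun z hz => ?_
  rw [compl_union_components]
  exact ⟨connectedComponentIn_subset _ _ hz, connectedComponentIn_eq hz ▸ hx'.2⟩

/-- The complement of a compact set that is locally a half plane has finitely many components. -/
theorem LocallyHalfPlane.finite_components [LocallyConnectedSpace X] [ConnectedSpace X]
    [T2Space X] (hS : LocallyHalfPlane K)
    (hK : IsCompact K) (hne : K.Nonempty) :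
    {Q | ∃ x ∉ K, Q = connectedComponentIn Kᶜ x}.Finite := by
  have hcoll : ∀ p ∈ frontier K, ∃ W, IsOpen W ∧ p ∈ W ∧ IsConnected (W \ K) := by
    intro p hp
    obtain ⟨W, -, hWo, hpW, -, hWK, -⟩ := hS.exists_collar hp Filter.univ_mem
    exact ⟨W, hWo, hpW, hWK⟩
  choose! W hWo hpW hWK using hcoll
  have hfrc : IsCompact (frontier K) :=
    hK.of_isClosed_subset isClosed_frontier hK.isClosed.frontier_subset
  -- Finitely many collars cover the frontier, each meets a single complementary component, and
  -- every component reaches the frontier.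
  obtain ⟨t, ht, hcov⟩ := hfrc.elim_nhds_subcover W fun p hp => (hWo p hp).mem_nhds (hpW p hp)
  choose! q hq using fun p hp => (hWK p hp).nonempty
  refine (t.finite_toSet.image fun p => connectedComponentIn Kᶜ (q p)).subset ?_
  rintro Q ⟨x, hx, rfl⟩
  obtain ⟨z, hz, hzK⟩ := closure_connectedComponentIn_compl_inter_nonempty hK.isClosed hne hx
  have hzf : z ∈ frontier K := by
    rw [← frontier_compl]
    refine ⟨closure_mono (connectedComponentIn_subset _ _) hz, fun h => ?_⟩
    exact interior_subset h hzK
  obtain ⟨p, hpt, hzp⟩ := mem_iUnion₂.1 (hcov hzf)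
  refine ⟨p, hpt, ?_⟩
  obtain ⟨w, hwW, hwQ⟩ := mem_closure_iff.1 hz _ (hWo p (ht p hpt)) hzp
  have hwK : w ∈ Kᶜ := connectedComponentIn_subset _ _ hwQ
  have h1 := (hWK p (ht p hpt)).isPreconnected.subset_connectedComponentIn ⟨hwW, hwK⟩
    (fun w (hw : w ∈ W p \ K) => mem_compl hw.2) (hq p (ht p hpt))
  simp only
  rw [connectedComponentIn_eq hwQ, connectedComponentIn_eq h1]

end Components

end Surf

/-! ### The two sides of a boundary component. -/

namespace Surf
open Set Metric

section FrontierComponent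

variable {X : Type*} [TopologicalSpace X] {S : Set X} {x p : X}

theorem LocallyHalfPlane.exists_collar_component (hS : LocallyHalfPlane S)
    (hp : p ∈ connectedComponentIn (frontier S) x) : ∃ W, IsOpen W ∧ p ∈ W ∧
      W ∩ frontier S ⊆ connectedComponentIn (frontier S) x ∧ IsConnected (W \ S) ∧
      IsConnected (W ∩ interior S) := by
  have hpf := connectedComponentIn_subset _ _ hp
  obtain ⟨W, -, hWo, hpW, -, h1, h2, h3⟩ := hS.exists_collar hpf Filter.univ_mem
  refine ⟨W, hWo, hpW, ?_, h1, h3⟩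
  rw [connectedComponentIn_eq hp]
  exact h2.isPreconnected.subset_connectedComponentIn ⟨hpW, hpf⟩ inter_subset_right

theorem LocallyHalfPlane.mem_closure_interior (hS : LocallyHalfPlane S) (hp : p ∈ frontier S) :
    p ∈ closure (interior S) := by
  rw [mem_closure_iff_nhds]
  intro N hN
  obtain ⟨W, hWN, -, -, -, -, -, h⟩ := hS.exists_collar hp hN
  exact h.nonempty.mono (inter_subset_inter_left _ hWN)

/-- Removing a boundary component does not disconnect. -/
theorem LocallyHalfPlane.isPreconnected_diff_component (hS : LocallyHalfPlane S)
    (hc : IsClosed S) (hconn : IsPreconnected S) :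
    IsPreconnected (S \ connectedComponentIn (frontier S) x) := by
  set γ := connectedComponentIn (frontier S) x with hγ
  have hγc : IsClosed γ := isClosed_connectedComponentIn isClosed_frontier
  have hintγ : Disjoint (interior S) γ :=
    disjoint_interior_frontier.mono_right (connectedComponentIn_subset _ _)
  -- For a separation `u`, `v` of `S \ γ`, this says that the inner collar at `p` lies in `u`. If
  -- that holds along all of `γ`, adjoining the collars to `u` separates `S` itself.
  let side : Set X → X → Prop := fun u p => ∃ N, IsOpen N ∧ p ∈ N ∧ N ∩ frontier S ⊆ γ ∧
    N ∩ interior S ⊆ u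
  have main : ∀ u v : Set X, IsOpen u → IsOpen v → S \ γ ⊆ u ∪ v → S \ γ ∩ (u ∩ v) = ∅ →
      (S \ γ ∩ u).Nonempty → (S \ γ ∩ v).Nonempty → ¬ ∀ p ∈ γ, side u p := by
    rintro u v hu hv huv hd ⟨z', hz'S, hz'u⟩ ⟨z, hzS, hzv⟩ hall
    choose! N hNo hpN hNγ hNu using hall
    obtain ⟨w, hwS, hwu, hwv, hwγ⟩ := hconn (u ∪ ⋃ p ∈ γ, N p) (v \ γ)
      (hu.union (isOpen_biUnion hNo)) (hv.sdiff hγc) (fun y hy => by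
        by_cases hyγ : y ∈ γ
        · exact Or.inl (Or.inr (mem_iUnion₂.2 ⟨y, hyγ, hpN y hyγ⟩))
        · rcases huv ⟨hy, hyγ⟩ with h | h
          · exact Or.inl (Or.inl h)
          · exact Or.inr ⟨h, hyγ⟩) ⟨z', hz'S.1, Or.inl hz'u⟩ ⟨z, hzS.1, hzv, hzS.2⟩
    refine eq_empty_iff_forall_notMem.1 hd w ⟨⟨hwS, hwγ⟩, ?_, hwv⟩
    rcases hwu with h | h
    · exact h
    · obtain ⟨p, hp, hwN⟩ := mem_iUnion₂.1 h
      refine hNu p hp ⟨hwN, ?_⟩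
      by_contra hwi
      exact hwγ (hNγ p hp ⟨hwN, by rw [hc.frontier_eq]; exact ⟨hwS, hwi⟩⟩)
  intro u v hu hv huv hneu hnev
  rw [nonempty_iff_ne_empty]
  intro hd
  have hintS : interior S ⊆ S \ γ := fun y hy =>
    ⟨interior_subset hy, disjoint_left.1 hintγ hy⟩
  have hcol : ∀ p ∈ γ, ∃ N, IsOpen N ∧ p ∈ N ∧ N ∩ frontier S ⊆ γ ∧
      (N ∩ interior S ⊆ u ∨ N ∩ interior S ⊆ v) := by
    intro p hp
    obtain ⟨N, hNo, hpN, hNγ, -, hNi⟩ := hS.exists_collar_component hp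
    refine ⟨N, hNo, hpN, hNγ, isPreconnected_iff_subset_of_disjoint.1 hNi.isPreconnected u v hu hv
      ((inter_subset_right.trans hintS).trans huv) ?_⟩
    exact subset_eq_empty (inter_subset_inter_left _ (inter_subset_right.trans hintS)) hd
  have hnot : ∀ p ∈ γ, ∀ N, IsOpen N → p ∈ N → N ∩ interior S ⊆ v → ¬ side u p := by
    rintro p hp N hNo hpN hNv ⟨N', hN'o, hpN', -, hN'u⟩
    obtain ⟨w, ⟨hwN, hwN'⟩, hw⟩ := mem_closure_iff.1
      (hS.mem_closure_interior (connectedComponentIn_subset _ _ hp)) _ (hNo.inter hN'o) ⟨hpN, hpN'⟩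
    exact eq_empty_iff_forall_notMem.1 hd w ⟨hintS hw, hN'u ⟨hwN', hw⟩, hNv ⟨hwN, hw⟩⟩
  -- The side is locally constant along the connected set `γ`.
  have hP : ∀ p ∈ γ, ∀ q ∈ γ, (side u p ↔ side u q) := by
    intro p hp q hq
    refine isPreconnected_connectedComponentIn.induction₂ (fun p q => (side u p ↔ side u q)) ?_
      (fun _ _ _ _ _ _ => Iff.trans) (fun _ _ _ _ => Iff.symm) hp hq
    intro p hp
    obtain ⟨N, hNo, hpN, hNγ, hN⟩ := hcol p hp
    filter_upwards [mem_nhdsWithin_of_mem_nhds (hNo.mem_nhds hpN), self_mem_nhdsWithin] with q hqN hq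
    rcases hN with hN | hN
    · exact iff_of_true ⟨N, hNo, hpN, hNγ, hN⟩ ⟨N, hNo, hqN, hNγ, hN⟩
    · exact iff_of_false (hnot p hp N hNo hpN hN) (hnot q hq N hNo hqN hN)
  by_cases h : ∀ p ∈ γ, side u p
  · exact main u v hu hv huv hd hneu hnev h
  · push Not at h
    obtain ⟨q, hq, hqu⟩ := h
    refine main v u hv hu (union_comm u v ▸ huv) (inter_comm u v ▸ hd) hnev hneu fun p hp => ?_
    obtain ⟨N, hNo, hpN, hNγ, hN | hN⟩ := hcol p hp
    · exact absurd ((hP p hp q hq).1 ⟨N, hNo, hpN, hNγ, hN⟩) hqu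
    · exact ⟨N, hNo, hpN, hNγ, hN⟩

/-- A single component of the complement lies on the other side of a boundary component. -/
theorem LocallyHalfPlane.exists_adjacent_component (hS : LocallyHalfPlane S)
    (hx : x ∈ frontier S) : ∃ q ∉ S, ∀ p ∈ connectedComponentIn (frontier S) x,
      ∃ W, IsOpen W ∧ p ∈ W ∧ W \ S ⊆ connectedComponentIn Sᶜ q := by
  set γ := connectedComponentIn (frontier S) x with hγ
  have hcol : ∀ p ∈ γ, ∃ W q, IsOpen W ∧ p ∈ W ∧ q ∉ S ∧ W \ S ⊆ connectedComponentIn Sᶜ q := by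
    intro p hp
    obtain ⟨W, hWo, hpW, -, hWS, -⟩ := hS.exists_collar_component hp
    obtain ⟨q, hqW, hqS⟩ := hWS.nonempty
    exact ⟨W, q, hWo, hpW, hqS, hWS.isPreconnected.subset_connectedComponentIn ⟨hqW, hqS⟩
      fun y hy => hy.2⟩
  choose! W q hWo hpW hqS hWq using hcol
  -- Overlapping collars contain common points outside `S`, so the adjacent component is locally
  -- constant along `γ`.
  have hP : ∀ p ∈ γ, ∀ p' ∈ γ, connectedComponentIn Sᶜ (q p) = connectedComponentIn Sᶜ (q p') := by
    intro p hp p' hp'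
    refine isPreconnected_connectedComponentIn.induction₂
      (fun p p' => connectedComponentIn Sᶜ (q p) = connectedComponentIn Sᶜ (q p')) ?_
      (fun _ _ _ _ _ _ => Eq.trans) (fun _ _ _ _ => Eq.symm) hp hp'
    intro p hp
    filter_upwards [mem_nhdsWithin_of_mem_nhds ((hWo p hp).mem_nhds (hpW p hp)),
      self_mem_nhdsWithin] with p' hp'W hp'
    have hfr := connectedComponentIn_subset _ _ hp'
    rw [← frontier_compl] at hfr
    obtain ⟨w, ⟨hw, hw'⟩, hwS⟩ := mem_closure_iff.1 hfr.1 _ ((hWo p hp).inter (hWo p' hp'))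
      ⟨hp'W, hpW p' hp'⟩
    rw [connectedComponentIn_eq (hWq p hp ⟨hw, hwS⟩), connectedComponentIn_eq (hWq p' hp' ⟨hw', hwS⟩)]
  have hxγ : x ∈ γ := mem_connectedComponentIn hx
  exact ⟨q x, hqS x hxγ, fun p hp => ⟨W p, hWo p hp, hpW p hp, hP p hp x hxγ ▸ hWq p hp⟩⟩

/-- A connected set that misses `γ` lies in `W` or misses it. If the connected set `S \ γ` misses
`W`, then `W` is a complementary component. If it lies in `W`, then `W` swallows every complementary
component except the one adjacent to `γ`. This is applied with `W` the interior of a disc or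
punctured disc bounded by `γ`. -/
theorem LocallyHalfPlane.eq_component_or_compl_component_subset [LocallyConnectedSpace X]
    [ConnectedSpace X] (hS : LocallyHalfPlane S) (hc : IsClosed S) (hconn : IsConnected S)
    (hx : x ∈ frontier S) {W : Set X} (hWo : IsOpen W) (hW : IsConnected W)
    (hWγ : Disjoint W (connectedComponentIn (frontier S) x))
    (hWc : IsClosed (W ∪ connectedComponentIn (frontier S) x)) :
    (∃ q ∉ S, W = connectedComponentIn Sᶜ q) ∨
      ∃ q ∉ S, (connectedComponentIn Sᶜ q)ᶜ ⊆ W ∪ connectedComponentIn (frontier S) x := by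
  set γ := connectedComponentIn (frontier S) x with hγ
  have hγS : γ ⊆ S := (connectedComponentIn_subset _ _).trans hc.frontier_subset
  have hdich : ∀ A : Set X, IsPreconnected A → Disjoint A γ → (A ∩ W).Nonempty → A ⊆ W := by
    intro A hA hAγ hne
    refine hA.subset_left_of_subset_union hWo hWc.isOpen_compl
      (disjoint_compl_right_iff_subset.2 subset_union_left) (fun y hy => ?_) hne
    by_cases hyW : y ∈ W
    · exact Or.inl hyW
    · exact Or.inr fun h => h.elim hyW (disjoint_left.1 hAγ hy)
  have hcompγ : ∀ q, Disjoint (connectedComponentIn Sᶜ q) γ := fun q =>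
    disjoint_left.2 fun y hy hyγ => connectedComponentIn_subset Sᶜ q hy (hγS hyγ)
  by_cases hmeet : (S \ γ ∩ W).Nonempty
  · right
    have hSW : S \ γ ⊆ W := hdich _ (hS.isPreconnected_diff_component hc hconn.isPreconnected)
      disjoint_sdiff_left hmeet
    obtain ⟨q, hq, hadj⟩ := hS.exists_adjacent_component hx
    refine ⟨q, hq, fun y hy => ?_⟩
    by_cases hyS : y ∈ S
    · by_cases hyγ : y ∈ γ
      · exact Or.inr hyγ
      · exact Or.inl (hSW ⟨hyS, hyγ⟩)
    left
    obtain ⟨p, hp, hpS⟩ := closure_connectedComponentIn_compl_inter_nonempty hc hconn.nonempty hyS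
    have hyQ : y ∈ connectedComponentIn Sᶜ y := mem_connectedComponentIn (mem_compl hyS)
    -- A component touching `S` on `γ` would be the excluded adjacent one; a component touching `S`
    -- elsewhere meets `W`.
    by_cases hpγ : p ∈ γ
    · obtain ⟨N, hNo, hpN, hN⟩ := hadj p hpγ
      obtain ⟨w, hwN, hw⟩ := mem_closure_iff.1 hp N hNo hpN
      have hwS : w ∈ Sᶜ := connectedComponentIn_subset _ _ hw
      have h1 := connectedComponentIn_eq (hN ⟨hwN, hwS⟩)
      rw [h1, ← connectedComponentIn_eq hw] at hy
      exact absurd hyQ hy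
    · refine hdich _ isPreconnected_connectedComponentIn (hcompγ y) ?_ hyQ
      obtain ⟨w, hwW, hw⟩ := mem_closure_iff.1 hp W hWo (hSW ⟨hpS, hpγ⟩)
      exact ⟨w, hw, hwW⟩
  · left
    obtain ⟨q, hq⟩ := hW.nonempty
    have hWS : W ⊆ Sᶜ := fun y hy hyS => hmeet ⟨y, ⟨hyS, disjoint_left.1 hWγ hy⟩, hy⟩
    refine ⟨q, hWS hq, (hW.isPreconnected.subset_connectedComponentIn hq hWS).antisymm ?_⟩
    exact hdich _ isPreconnected_connectedComponentIn (hcompγ q)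
      ⟨q, mem_connectedComponentIn (hWS hq), hq⟩

end FrontierComponent

end Surf

/-! ### Embedded discs and punctured discs. -/

namespace Surf
open Set Metric

section Discs

variable {X : Type*} [TopologicalSpace X]

theorem isConnected_punctured_ball {ε : ℝ} (hε : 0 < ε) :
    IsConnected {z : ℂ | z ≠ 0 ∧ ‖z‖ < ε} := by
  have : {z : ℂ | z ≠ 0 ∧ ‖z‖ < ε} =
      (fun p : ℝ × ℝ => (p.1 : ℂ) * Complex.exp (p.2 * Complex.I)) '' (Ioo 0 ε ×ˢ univ) := by
    ext z
    constructor
    · rintro ⟨hz, hzε⟩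
      exact ⟨(‖z‖, z.arg), ⟨⟨norm_pos_iff.2 hz, hzε⟩, mem_univ _⟩, Complex.norm_mul_exp_arg_mul_I z⟩
    · rintro ⟨⟨r, θ⟩, ⟨hr, -⟩, rfl⟩
      refine ⟨mul_ne_zero (by exact_mod_cast hr.1.ne') (Complex.exp_ne_zero _), ?_⟩
      simpa [Complex.norm_exp_ofReal_mul_I, abs_of_pos hr.1] using hr.2
  rw [this]
  exact ((isConnected_Ioo hε).prod isConnected_univ).image _
    (Continuous.continuousOn (by fun_prop))

/-- Invariance of domain, for maps defined only on a subtype of the plane; outside `p` the map is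
extended by an irrelevant constant. -/
theorem isOpen_image_subtype [ChartedSpace Plane X] {p : ℂ → Prop} {d : {z // p z} → X}
    (hd : Continuous d) (hinj : Function.Injective d) {U : Set ℂ} (hU : IsOpen U)
    (hUp : ∀ z ∈ U, p z) : IsOpen (d '' {z | (z : ℂ) ∈ U}) := by
  rcases U.eq_empty_or_nonempty with rfl | ⟨z₀, hz₀⟩
  · simp
  classical
  let f : ℂ → X := fun z => if h : p z then d ⟨z, h⟩ else d ⟨z₀, hUp z₀ hz₀⟩
  have hf : ∀ z (h : p z), f z = d ⟨z, h⟩ := fun z h => dif_pos h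
  have himg : d '' {z | (z : ℂ) ∈ U} = f '' U := by
    ext x
    constructor
    · rintro ⟨z, hz, rfl⟩
      exact ⟨z, hz, hf z z.2⟩
    · rintro ⟨z, hz, rfl⟩
      exact ⟨⟨z, hUp z hz⟩, hz, (hf z (hUp z hz)).symm⟩
  rw [himg]
  refine isOpen_image_of_continuousOn_injOn hU ?_ ?_
  · rw [continuousOn_iff_continuous_domRestrict]
    have : U.domRestrict f = fun z : U => d ⟨z, hUp z z.2⟩ := by
      funext z; exact hf z (hUp z z.2)
    rw [this]
    exact hd.comp (by fun_prop)
  · intro z hz w hw hzw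
    rw [hf z (hUp z hz), hf w (hUp w hw)] at hzw
    exact congrArg Subtype.val (hinj hzw)

theorem isConnected_image_subtype {p : ℂ → Prop} {d : {z // p z} → X}
    (hd : Continuous d) {U : Set ℂ} (hU : IsConnected U)
    (hUp : ∀ z ∈ U, p z) : IsConnected (d '' {z | (z : ℂ) ∈ U}) := by
  have : d '' {z | (z : ℂ) ∈ U} = (fun z : U => d ⟨z, hUp z z.2⟩) '' univ := by
    ext x
    constructor
    · rintro ⟨z, hz, rfl⟩
      exact ⟨⟨z, hz⟩, mem_univ _, rfl⟩
    · rintro ⟨z, -, rfl⟩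
      exact ⟨⟨z, hUp z z.2⟩, z.2, rfl⟩
  rw [this]
  have : ConnectedSpace U := isConnected_iff_connectedSpace.1 hU
  exact isConnected_univ.image _ (hd.comp (by fun_prop)).continuousOn

theorem image_lt_union_image_eq {X : Type*} {p : ℂ → Prop} (hp : ∀ z, p z → ‖z‖ ≤ 1) (d : {z // p z} → X) :
    d '' {z | ‖(z : ℂ)‖ < 1} ∪ d '' {z | ‖(z : ℂ)‖ = 1} = range d := by
  rw [← image_union, ← image_univ]
  congr 1
  ext z
  simpa using (hp z z.2).lt_or_eq

theorem disjoint_image_lt_image_eq {X : Type*} {p : ℂ → Prop} {d : {z // p z} → X}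
    (hinj : Function.Injective d) :
    Disjoint (d '' {z | ‖(z : ℂ)‖ < 1}) (d '' {z | ‖(z : ℂ)‖ = 1}) := by
  rw [disjoint_image_iff hinj, disjoint_left]
  intro z hz hz'
  exact absurd hz' (ne_of_lt hz)

theorem PuncturedDisc.image_lt_eq {X : Type*} (d : PuncturedDisc → X) :
    d '' {z | ‖(z : ℂ)‖ < 1} = d '' {z | (z : ℂ) ∈ {z : ℂ | z ≠ 0 ∧ ‖z‖ < 1}} := by
  congr 1
  ext z
  simp [z.2.1]

theorem Disc.image_lt_eq {X : Type*} (d : Disc → X) :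
    d '' {z | ‖(z : ℂ)‖ < 1} = d '' {z | (z : ℂ) ∈ ball (0 : ℂ) 1} := by
  simp

theorem PuncturedDisc.isOpen_interior [ChartedSpace Plane X] {d : PuncturedDisc → X}
    (hd : Topology.IsClosedEmbedding d) : IsOpen (d '' {z | ‖(z : ℂ)‖ < 1}) := by
  rw [PuncturedDisc.image_lt_eq]
  exact isOpen_image_subtype hd.continuous hd.injective
    (isOpen_ne.inter (isOpen_lt continuous_norm continuous_const)) fun z hz => ⟨hz.1, hz.2.le⟩

theorem Disc.isOpen_interior [ChartedSpace Plane X] {d : Disc → X}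
    (hd : Topology.IsClosedEmbedding d) : IsOpen (d '' {z | ‖(z : ℂ)‖ < 1}) := by
  rw [Disc.image_lt_eq]
  exact isOpen_image_subtype hd.continuous hd.injective isOpen_ball fun z hz =>
    (mem_ball_zero_iff.1 hz).le

theorem PuncturedDisc.isConnected_interior {d : PuncturedDisc → X}
    (hd : Continuous d) : IsConnected (d '' {z | ‖(z : ℂ)‖ < 1}) := by
  rw [PuncturedDisc.image_lt_eq]
  exact isConnected_image_subtype hd (isConnected_punctured_ball one_pos) fun z hz =>
    ⟨hz.1, hz.2.le⟩

theorem Disc.isConnected_interior {d : Disc → X}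
    (hd : Continuous d) : IsConnected (d '' {z | ‖(z : ℂ)‖ < 1}) := by
  rw [Disc.image_lt_eq]
  exact isConnected_image_subtype hd
    ⟨⟨0, by simp⟩, (convex_ball (0 : ℂ) 1).isPreconnected⟩ fun z hz =>
    (mem_ball_zero_iff.1 hz).le

theorem PuncturedDisc.image_eq_subset_closure {d : PuncturedDisc → X} (hd : Continuous d) :
    d '' {z | ‖(z : ℂ)‖ = 1} ⊆ closure (d '' {z | ‖(z : ℂ)‖ < 1}) := by
  rintro _ ⟨z, hz, rfl⟩
  refine image_closure_subset_closure_image hd ⟨z, ?_, rfl⟩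
  have hz' : ‖(z : ℂ)‖ = 1 := hz
  let s : Ioc (0 : ℝ) 1 → PuncturedDisc := fun t => ⟨t.1 * z, mul_ne_zero
    (by exact_mod_cast t.2.1.ne') z.2.1, by simpa [hz', abs_of_pos t.2.1] using t.2.2⟩
  have hs : Continuous s := by fun_prop
  have h1 : z = s ⟨1, by simp⟩ := by ext; simp [s]
  rw [h1]
  have h2 : (⟨1, by simp⟩ : Ioc (0 : ℝ) 1) ∈ closure {t : Ioc (0 : ℝ) 1 | t.1 < 1} := by
    rw [closure_subtype]
    have : Subtype.val '' {t : Ioc (0 : ℝ) 1 | t.1 < 1} = Ioo 0 1 := by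
      ext t
      simp only [mem_image, mem_ofPred_eq, Subtype.exists, mem_Ioc, exists_and_left, exists_prop,
        mem_Ioo]
      constructor
      · rintro ⟨a, ha, hb, rfl⟩; exact ⟨hb.1, ha⟩
      · rintro ⟨ha, hb⟩; exact ⟨t, hb, ⟨ha, hb.le⟩, rfl⟩
    rw [this, closure_Ioo (by norm_num)]
    simp
  refine closure_mono ?_ (image_closure_subset_closure_image hs ⟨_, h2, rfl⟩)
  rintro _ ⟨t, ht, rfl⟩
  simpa [s, hz', abs_of_pos t.2.1] using ht

end Discs

end Surf

/-! ### Filling a compact set to an essential subsurface of finite type. -/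

namespace Surf
open Set Metric

section Filling

variable {X : Type*} [TopologicalSpace X]

/-- A complementary region that is relatively compact or an open punctured disc. -/
def SmallRegion (Q : Set X) : Prop :=
  IsCompact (closure Q) ∨
    ∃ d : PuncturedDisc → X, Topology.IsClosedEmbedding d ∧ Q = d '' {z | ‖(z : ℂ)‖ < 1}

/-- `K` together with its small complementary components. -/
def fill (K : Set X) : Set X := K ∪ {y | y ∉ K ∧ SmallRegion (connectedComponentIn Kᶜ y)}

variable {K : Set X}

theorem IsSubsurface.fill [LocallyConnectedSpace X] [ConnectedSpace X] (hS : LocallyHalfPlane K)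
    (hK : IsClosed K) (hc : IsConnected K) : IsSubsurface (fill K) :=
  ⟨isClosed_union_components hK _, isConnected_union_components hK hc _,
    hS.union_components hK _⟩

theorem connectedComponentIn_eq_of_inter_nonempty {F : Set X} {x y : X}
    (h : (connectedComponentIn F x ∩ connectedComponentIn F y).Nonempty) :
    connectedComponentIn F x = connectedComponentIn F y := by
  obtain ⟨z, hx, hy⟩ := h
  rw [connectedComponentIn_eq hx, connectedComponentIn_eq hy]

/-- The outer side of a collar is connected, so a frontier point touches only one complementary
component. -/
theorem LocallyHalfPlane.eq_of_mem_closure [LocallyConnectedSpace X] (hS : LocallyHalfPlane K)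
    {w x y : X} (hw : w ∈ frontier K) (hx : w ∈ closure (connectedComponentIn Kᶜ x))
    (hy : w ∈ closure (connectedComponentIn Kᶜ y)) :
    connectedComponentIn Kᶜ x = connectedComponentIn Kᶜ y := by
  obtain ⟨W, -, hWo, hwW, -, hWK, -⟩ := hS.exists_collar hw Filter.univ_mem
  have key : ∀ x, w ∈ closure (connectedComponentIn Kᶜ x) → W \ K ⊆ connectedComponentIn Kᶜ x := by
    intro x hx
    obtain ⟨u, huW, hu⟩ := mem_closure_iff.1 hx W hWo hwW
    rw [connectedComponentIn_eq hu]
    exact hWK.isPreconnected.subset_connectedComponentIn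
      ⟨huW, fun h => connectedComponentIn_subset _ _ hu h⟩ fun y hy => hy.2
  obtain ⟨u, hu⟩ := hWK.nonempty
  exact connectedComponentIn_eq_of_inter_nonempty ⟨u, key x hx hu, key y hy hu⟩

/-- The required punctured discs are the complementary components of that shape, finite in number.
Their boundary circles lie on the frontier of `K`, where distinct components have no common limit
point. The rest is closed in the union of `K` and finitely many compact closures. -/
theorem IsFiniteType.fill [T2Space X] [LocallyConnectedSpace X] [ConnectedSpace X]
    (hS : LocallyHalfPlane K) (hK : IsCompact K) (hne : K.Nonempty) : IsFiniteType (fill K) := by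
  have hfin := hS.finite_components hK hne
  set 𝒬 := {Q | ∃ x ∉ K, Q = connectedComponentIn Kᶜ x} with h𝒬
  let 𝒟 := {Q ∈ 𝒬 | ∃ d : PuncturedDisc → X, Topology.IsClosedEmbedding d ∧
    Q = d '' {z | ‖(z : ℂ)‖ < 1}}
  have h𝒟 : 𝒟.Finite := hfin.subset fun Q hQ => hQ.1
  have : Finite 𝒟 := h𝒟
  obtain ⟨n, ⟨e⟩⟩ := Finite.exists_equiv_fin 𝒟
  choose d hd hQd using fun Q : 𝒟 => Q.2.2
  have hKo : IsOpen Kᶜ := hK.isClosed.isOpen_compl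
  have hbd : ∀ Q : 𝒟, d Q '' {z | ‖(z : ℂ)‖ = 1} ⊆ frontier K ∩ closure Q.1 := by
    rintro Q w hw
    have hwQ : w ∈ closure Q.1 := by
      rw [hQd Q]
      exact PuncturedDisc.image_eq_subset_closure (hd Q).continuous hw
    refine ⟨?_, hwQ⟩
    obtain ⟨x, hx, hQx⟩ := Q.2.1
    rw [hK.isClosed.frontier_eq]
    refine ⟨?_, fun h => ?_⟩
    · by_contra hwK
      obtain ⟨u, hu, huQ⟩ := mem_closure_iff.1 hwQ _ hKo.connectedComponentIn
        (mem_connectedComponentIn (mem_compl hwK))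
      rw [hQx] at huQ
      have h1 := connectedComponentIn_eq_of_inter_nonempty ⟨u, hu, huQ⟩
      have h2 : w ∈ Q.1 := by
        rw [hQx, ← h1]; exact mem_connectedComponentIn (mem_compl hwK)
      rw [hQd Q] at h2
      exact disjoint_left.1 (disjoint_image_lt_image_eq (hd Q).injective) h2 hw
    · obtain ⟨u, hu, huQ⟩ := mem_closure_iff.1 hwQ _ isOpen_interior h
      rw [hQx] at huQ
      exact connectedComponentIn_subset _ _ huQ (interior_subset hu)
  have hran : ∀ Q : 𝒟, range (d Q) = Q.1 ∪ d Q '' {z | ‖(z : ℂ)‖ = 1} := by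
    intro Q
    rw [← image_lt_union_image_eq (fun z hz => hz.2) (d Q), ← hQd Q]
  have hQK : ∀ Q : 𝒟, Q.1 ⊆ Kᶜ := by
    intro Q
    obtain ⟨x, hx, hQx⟩ := Q.2.1
    rw [hQx]; exact connectedComponentIn_subset _ _
  have hbdK : ∀ Q : 𝒟, d Q '' {z | ‖(z : ℂ)‖ = 1} ⊆ K := fun Q =>
    (hbd Q).trans (inter_subset_left.trans hK.isClosed.frontier_subset)
  refine ⟨n, fun i => d (e.symm i), fun i => ⟨hd _, ?_⟩, fun i j hij => ?_, ?_⟩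
  · rw [hran]
    refine union_subset (fun y hy => Or.inr ⟨hQK _ hy, Or.inr ⟨d (e.symm i), hd _, ?_⟩⟩)
      ((hbdK _).trans subset_union_left)
    obtain ⟨x, hx, hQx⟩ := (e.symm i).2.1
    rw [← hQd, hQx]
    rw [hQx] at hy
    exact (connectedComponentIn_eq hy).symm
  · have hne : e.symm i ≠ e.symm j := fun h => hij (e.symm.injective h)
    change Disjoint (range (d (e.symm i))) (range (d (e.symm j)))
    generalize e.symm i = P at *
    generalize e.symm j = Q at *
    obtain ⟨x, hx, hPx⟩ := P.2.1
    obtain ⟨y, hy, hQy⟩ := Q.2.1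
    have hxy : connectedComponentIn Kᶜ x ≠ connectedComponentIn Kᶜ y := fun h =>
      hne (Subtype.ext (by rw [hPx, hQy, h]))
    rw [hran, hran, disjoint_left]
    rintro w (hw | hw) (hw' | hw')
    · rw [hPx] at hw; rw [hQy] at hw'
      exact hxy (connectedComponentIn_eq_of_inter_nonempty ⟨w, hw, hw'⟩)
    · exact hQK P hw (hbdK Q hw')
    · exact hQK Q hw' (hbdK P hw)
    · have h1 := (hbd P hw).2
      have h2 := (hbd Q hw').2
      rw [hPx] at h1; rw [hQy] at h2
      exact hxy (hS.eq_of_mem_closure (hbd P hw).1 h1 h2)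
  · have heq : ⋃ i, d (e.symm i) '' {z | ‖(z : ℂ)‖ < 1} = ⋃ Q : 𝒟, Q.1 := by
      rw [e.symm.surjective.iUnion_comp (fun Q => d Q '' {z | ‖(z : ℂ)‖ < 1})]
      exact iUnion_congr fun Q => (hQd Q).symm
    rw [heq]
    have hopen : IsOpen (⋃ Q : 𝒟, Q.1) := by
      refine isOpen_iUnion fun Q => ?_
      obtain ⟨x, hx, hQx⟩ := Q.2.1
      rw [hQx]; exact hKo.connectedComponentIn
    have hcomp : IsCompact (K ∪ ⋃ Q ∈ {Q ∈ 𝒬 | IsCompact (closure Q)}, closure Q) :=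
      hK.union ((hfin.subset fun Q hQ => hQ.1).isCompact_biUnion fun Q hQ => hQ.2)
    refine hcomp.of_isClosed_subset
      ((isClosed_union_components hK.isClosed _).sdiff hopen) ?_
    rintro y ⟨hy | ⟨hyK, hc | hd'⟩, hyn⟩
    · exact Or.inl hy
    · exact Or.inr (mem_biUnion (x := connectedComponentIn Kᶜ y) ⟨⟨y, hyK, rfl⟩, hc⟩
        (subset_closure (mem_connectedComponentIn (mem_compl hyK))))
    · let Q : 𝒟 := ⟨connectedComponentIn Kᶜ y, ⟨y, hyK, rfl⟩, hd'⟩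
      exact absurd (mem_iUnion.2 ⟨Q, (mem_connectedComponentIn (mem_compl hyK) :
        y ∈ connectedComponentIn Kᶜ y)⟩) hyn

theorem compactSpace_disc : CompactSpace Disc := by
  refine ⟨Topology.IsInducing.subtypeVal.isCompact_iff.2 ?_⟩
  have himg : Subtype.val '' (univ : Set Disc) = closedBall (0 : ℂ) 1 := by
    ext z
    rw [mem_closedBall_zero_iff]
    exact ⟨fun ⟨w, _, h⟩ => h ▸ w.2, fun h => ⟨⟨z, h⟩, mem_univ _, rfl⟩⟩
  exact himg ▸ isCompact_closedBall (0 : ℂ) 1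

/-- By the dichotomy for `γ`, the interior of a disc bounded by a boundary curve is either a
complementary component, which is small and would have been filled, or its closure contains
everything outside one complementary component, which `hdisc` and `hpdisc` exclude. -/
theorem IsEssential.fill [LocallyConnectedSpace X] [ConnectedSpace X] [ChartedSpace Plane X]
    (hS : LocallyHalfPlane K) (hK : IsClosed K) (hc : IsConnected K)
    (hdisc : ∀ q ∉ K, ∀ d : Disc → X, Topology.IsClosedEmbedding d →
      ¬ (connectedComponentIn Kᶜ q)ᶜ ⊆ range d)
    (hpdisc : ∀ q ∉ K, ∀ d : PuncturedDisc → X, Topology.IsClosedEmbedding d →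
      ¬ (connectedComponentIn Kᶜ q)ᶜ ⊆ range d) : IsEssential (fill K) := by
  obtain ⟨hSc, hSconn, hSh⟩ := IsSubsurface.fill hS hK hc
  have hnot : ∀ q ∉ Surf.fill K, q ∉ K ∧ connectedComponentIn (Surf.fill K)ᶜ q =
      connectedComponentIn Kᶜ q ∧ ¬ SmallRegion (connectedComponentIn Kᶜ q) := by
    intro q hq
    have hqK : q ∉ K := fun h => hq (Or.inl h)
    exact ⟨hqK, connectedComponentIn_compl_union_components _ hq, fun h => hq (Or.inr ⟨hqK, h⟩)⟩
  intro x hx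
  constructor
  · rintro ⟨d, hd, hdγ⟩
    have hun := image_lt_union_image_eq (fun z hz => hz) d
    have hdis := disjoint_image_lt_image_eq hd.injective
    rw [hdγ] at hun hdis
    rcases LocallyHalfPlane.eq_component_or_compl_component_subset hSh hSc hSconn hx
      (Disc.isOpen_interior hd) (Disc.isConnected_interior hd.continuous) hdis
      (hun ▸ hd.isClosed_range) with ⟨q, hq, h⟩ | ⟨q, hq, h⟩
    · obtain ⟨-, hqe, hsmall⟩ := hnot q hq
      refine hsmall (Or.inl ?_)
      rw [← hqe, ← h]
      have : CompactSpace Disc := compactSpace_disc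
      exact (isCompact_range hd.continuous).of_isClosed_subset isClosed_closure
        (closure_minimal (image_subset_range _ _) hd.isClosed_range)
    · obtain ⟨hqK, hqe, -⟩ := hnot q hq
      rw [hqe, hun] at h
      exact hdisc q hqK d hd h
  · rintro ⟨d, hd, hdγ⟩
    have hun := image_lt_union_image_eq (fun z hz => hz.2) d
    have hdis := disjoint_image_lt_image_eq hd.injective
    rw [hdγ] at hun hdis
    rcases LocallyHalfPlane.eq_component_or_compl_component_subset hSh hSc hSconn hx
      (PuncturedDisc.isOpen_interior hd) (PuncturedDisc.isConnected_interior hd.continuous) hdis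
      (hun ▸ hd.isClosed_range) with ⟨q, hq, h⟩ | ⟨q, hq, h⟩
    · obtain ⟨-, hqe, hsmall⟩ := hnot q hq
      exact hsmall (Or.inr ⟨d, hd, hqe ▸ h.symm⟩)
    · obtain ⟨hqK, hqe, -⟩ := hnot q hq
      rw [hqe, hun] at h
      exact hpdisc q hqK d hd h

end Filling

/-! ### Complementary regions of a displaced set. -/

section Displacement

variable {X : Type*} [TopologicalSpace X] {S : Set X}

/-- If `f` displaces `S`, one complementary component of `S` and one of `f S` cover. -/
theorem exists_components_cover_of_disjoint_image [LocallyConnectedSpace X] [ConnectedSpace X]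
    (hS : IsClosed S) (hc : IsConnected S) (f : X ≃ₜ X) (hf : ¬ (f '' S ∩ S).Nonempty) :
    ∃ p ∉ S, ∃ q ∉ S, ∀ x, x ∈ connectedComponentIn Sᶜ p ∨ x ∈ f '' connectedComponentIn Sᶜ q := by
  obtain ⟨s, hs⟩ := hc.nonempty
  have hfS : f '' S ⊆ Sᶜ := fun y hy hyS => hf ⟨y, hy, hyS⟩
  have hpS : f s ∈ Sᶜ := hfS ⟨s, hs, rfl⟩
  have hqS : f.symm s ∈ Sᶜ := fun h => hf ⟨s, ⟨f.symm s, h, by simp⟩, hs⟩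
  refine ⟨f s, hpS, f.symm s, hqS, fun x => ?_⟩
  by_contra! hx
  have hfSc : f '' S ⊆ connectedComponentIn Sᶜ (f s) :=
    (hc.image f f.continuous.continuousOn).isPreconnected.subset_connectedComponentIn
      ⟨s, hs, rfl⟩ hfS
  -- `f(S)` lies in one complementary component. The complement `T` of that component is connected
  -- and misses `f(S)`, so `f⁻¹(T)` lies in a single complementary component of `S`.
  have hT : IsConnected (S ∪ {y | y ∉ S ∧ connectedComponentIn Sᶜ y ≠
      connectedComponentIn Sᶜ (f s)}) :=
    isConnected_union_components hS hc (fun Q => Q ≠ connectedComponentIn Sᶜ (f s))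
  set T := S ∪ {y | y ∉ S ∧ connectedComponentIn Sᶜ y ≠ connectedComponentIn Sᶜ (f s)} with hTdef
  have hxT : x ∈ T := by
    by_cases hxS : x ∈ S
    · exact Or.inl hxS
    · exact Or.inr ⟨hxS, fun h => hx.1 (h ▸ mem_connectedComponentIn (mem_compl hxS))⟩
  have hTf : f.symm '' T ⊆ Sᶜ := by
    rintro _ ⟨y, hy, rfl⟩ hyS
    have hyf : y ∈ f '' S := ⟨f.symm y, hyS, by simp⟩
    rcases hy with h | ⟨-, h⟩
    · exact hf ⟨y, hyf, h⟩
    · exact h (connectedComponentIn_eq (hfSc hyf)).symm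
  have := (hT.image f.symm f.symm.continuous.continuousOn).isPreconnected.subset_connectedComponentIn
      (mem_image_of_mem _ (Or.inl hs)) hTf ⟨x, hxT, rfl⟩
  exact hx.2 ⟨f.symm x, this, by simp⟩

end Displacement

end Surf

/-! ### Connected compact exhaustion. -/

namespace Surf
open Set Metric TopologicalSpace

section ConnectedCompact

variable {X : Type*} [TopologicalSpace X] [T2Space X] [ConnectedSpace X]

/-- The points joined to `x₀` by a connected compact set form a clopen set, hence everything;
finitely many joining sets and compact connected neighbourhoods capture `L`. -/
theorem exists_isConnected_isCompact_superset [LocallyConnectedSpace X] [LocallyCompactSpace X]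
    {L : Set X} (hL : IsCompact L) : ∃ C, IsCompact C ∧ IsConnected C ∧ L ⊆ C := by
  have hnb : ∀ y : X, ∃ N ∈ nhds y, IsCompact N ∧ IsPreconnected N := by
    intro y
    obtain ⟨N, hN, hyN⟩ := exists_compact_mem_nhds y
    refine ⟨closure (connectedComponentIn N y), Filter.mem_of_superset
      (connectedComponentIn_mem_nhds hyN) subset_closure, ?_,
      isPreconnected_connectedComponentIn.closure⟩
    exact hN.of_isClosed_subset isClosed_closure
      (closure_minimal (connectedComponentIn_subset _ _) hN.isClosed)
  choose N hN hNc hNp using hnb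
  obtain ⟨x₀⟩ := (inferInstance : Nonempty X)
  have hjoin : ∀ y, ∃ C, IsCompact C ∧ IsPreconnected C ∧ x₀ ∈ C ∧ y ∈ C := by
    have : IsClopen {y | ∃ C, IsCompact C ∧ IsPreconnected C ∧ x₀ ∈ C ∧ y ∈ C} := by
      constructor
      · rw [← closure_subset_iff_isClosed]
        intro y hy
        obtain ⟨z, hz, C, hCc, hCp, h0, hzC⟩ := mem_closure_iff_nhds.1 hy _ (hN y)
        exact ⟨C ∪ N y, hCc.union (hNc y), hCp.union z hzC hz (hNp y), Or.inl h0,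
          Or.inr (mem_of_mem_nhds (hN y))⟩
      · rw [isOpen_iff_mem_nhds]
        rintro y ⟨C, hCc, hCp, h0, hyC⟩
        refine Filter.mem_of_superset (hN y) fun z hz => ?_
        exact ⟨C ∪ N y, hCc.union (hNc y), hCp.union y hyC (mem_of_mem_nhds (hN y)) (hNp y),
          Or.inl h0, Or.inr hz⟩
    have huniv := this.eq_univ ⟨x₀, {x₀}, isCompact_singleton, isPreconnected_singleton, rfl, rfl⟩
    exact fun y => huniv.symm.subset (mem_univ y)
  choose C hCc hCp h0 hyC using hjoin
  obtain ⟨t, ht⟩ := hL.elim_finite_subcover (fun y => interior (N y)) (fun y => isOpen_interior)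
    fun y _ => mem_iUnion.2 ⟨y, mem_interior_iff_mem_nhds.2 (hN y)⟩
  refine ⟨C x₀ ∪ ⋃ y ∈ t, (C y ∪ N y),
    (hCc x₀).union (t.isCompact_biUnion fun y _ => (hCc y).union (hNc y)), ⟨⟨x₀, Or.inl (h0 x₀)⟩, ?_⟩, ?_⟩
  · have hpart : ∀ y, IsPreconnected (C y ∪ N y) := fun y =>
      (hCp y).union y (hyC y) (mem_of_mem_nhds (hN y)) (hNp y)
    refine isPreconnected_of_forall x₀ ?_
    rintro z (hz | hz)
    · exact ⟨C x₀, subset_union_left, h0 x₀, hz, hCp x₀⟩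
    · obtain ⟨y, hy, hzy⟩ := mem_iUnion₂.1 hz
      exact ⟨C y ∪ N y, (subset_biUnion_of_mem (u := fun y => C y ∪ N y) hy).trans
        subset_union_right, Or.inl (h0 y), hzy, hpart y⟩
  · intro z hz
    obtain ⟨y, hy, hzy⟩ := mem_iUnion₂.1 (ht hz)
    exact Or.inr (mem_iUnion₂.2 ⟨y, hy, Or.inr (interior_subset hzy)⟩)

theorem exists_isConnected_locallyHalfPlane [SecondCountableTopology X] [ChartedSpace Plane X]
    [IsManifold (𝓡 2) ∞ X] {L : Set X} (hL : IsCompact L) :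
    ∃ K, IsCompact K ∧ IsConnected K ∧ LocallyHalfPlane K ∧ L ⊆ K := by
  have : LocallyCompactSpace X := ChartedSpace.locallyCompactSpace Plane X
  have : LocallyConnectedSpace X := ChartedSpace.locallyConnectedSpace Plane X
  obtain ⟨C, hC, hCc, hLC⟩ := exists_isConnected_isCompact_superset hL
  obtain ⟨K, hK, hCK, hKh⟩ := exists_isCompact_locallyHalfPlane hC
  obtain ⟨x, hx⟩ := hCc.nonempty
  refine ⟨connectedComponentIn K x, hK.of_isClosed_subset
    (isClosed_connectedComponentIn hK.isClosed) (connectedComponentIn_subset _ _),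
    isConnected_connectedComponentIn_iff.2 (hCK hx), hKh.component hK.isClosed,
    hLC.trans (hCc.isPreconnected.subset_connectedComponentIn hx hCK)⟩

end ConnectedCompact

/-! ### Topology of the end space and the action of homeomorphisms on it. -/

namespace EndSpace

section Basic

variable {X : Type*} [TopologicalSpace X] (e e' : EndSpace X) {K L : Compacts X}

theorem nonempty_apply (K : Compacts X) : (e.1 K).Nonempty := by
  obtain ⟨x, hx, h⟩ := e.2.1 K
  exact h ▸ ⟨x, mem_connectedComponentIn hx⟩

theorem apply_mono (h : K ≤ L) : e.1 L ⊆ e.1 K := e.2.2 K L h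

theorem apply_subset_compl (K : Compacts X) : e.1 K ⊆ (K : Set X)ᶜ := by
  obtain ⟨x, hx, h⟩ := e.2.1 K
  exact h ▸ connectedComponentIn_subset _ _

variable {e e'}

theorem apply_eq_of_mem {x : X} (hx : x ∈ e.1 K) : e.1 K = connectedComponentIn (K : Set X)ᶜ x := by
  obtain ⟨y, hy, h⟩ := e.2.1 K
  rw [h] at hx ⊢
  exact connectedComponentIn_eq hx

theorem subset_apply {A : Set X} (hA : IsPreconnected A) (hAK : A ⊆ (K : Set X)ᶜ)
    (h : (A ∩ e.1 K).Nonempty) : A ⊆ e.1 K := by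
  obtain ⟨x, hxA, hx⟩ := h
  rw [apply_eq_of_mem hx]
  exact hA.subset_connectedComponentIn hxA hAK

theorem apply_eq_of_nonempty (h : (e.1 K ∩ e'.1 K).Nonempty) : e.1 K = e'.1 K := by
  obtain ⟨x, hx, hx'⟩ := h
  rw [apply_eq_of_mem hx, apply_eq_of_mem hx']

theorem apply_eq_of_le (hKL : K ≤ L) (h : e.1 L = e'.1 L) : e.1 K = e'.1 K := by
  obtain ⟨x, hx⟩ := e.nonempty_apply L
  exact apply_eq_of_nonempty ⟨x, e.apply_mono hKL hx, e'.apply_mono hKL (h ▸ hx)⟩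

theorem isOpen_setOf_apply_eq (K : Compacts X) (U : Set X) :
    IsOpen {e : EndSpace X | e.1 K = U} := isOpen_generateFrom_of_mem ⟨K, U, rfl⟩

theorem isClopen_setOf_apply_eq (K : Compacts X) (U : Set X) :
    IsClopen {e : EndSpace X | e.1 K = U} := by
  refine ⟨?_, isOpen_setOf_apply_eq K U⟩
  have : {e : EndSpace X | e.1 K = U}ᶜ = ⋃ V ∈ {V | V ≠ U}, {e : EndSpace X | e.1 K = V} := by
    ext e; simp
  rw [← isOpen_compl_iff, this]
  exact isOpen_biUnion fun V _ => isOpen_setOf_apply_eq K V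

theorem exists_apply_ne (h : e ≠ e') : ∃ K, e.1 K ≠ e'.1 K := by
  by_contra! hcon
  exact h (Subtype.ext (funext hcon))

instance : TotallySeparatedSpace (EndSpace X) := by
  rw [totallySeparatedSpace_iff_exists_isClopen]
  intro e e' h
  obtain ⟨K, hK⟩ := exists_apply_ne h
  exact ⟨_, isClopen_setOf_apply_eq K (e.1 K), rfl, fun h => hK h.symm⟩

/-- Compact sets are directed under union and a larger one determines the component at a smaller
one, so finite intersections of generators need only one compact set. -/
theorem exists_subset_of_mem_nhds {U : Set (EndSpace X)} (hU : U ∈ nhds e) :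
    ∃ K : Compacts X, {e' | e'.1 K = e.1 K} ⊆ U := by
  obtain ⟨V, hVU, hV, heV⟩ := mem_nhds_iff.1 hU
  suffices ∃ K : Compacts X, {e' | e'.1 K = e.1 K} ⊆ V from this.imp fun K h => h.trans hVU
  clear hU hVU U
  have hV' : GenerateOpen {s | ∃ (K : Compacts X) (U : Set X),
    s = {e : EndSpace X | e.1 K = U}} V := hV
  clear hV
  induction hV' generalizing e with
  | basic s hs =>
    obtain ⟨K, U, rfl⟩ := hs
    exact ⟨K, fun e' he' => Eq.trans he' heV⟩
  | univ => exact ⟨⊥, subset_univ _⟩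
  | inter s t _ _ ihs iht =>
    obtain ⟨K, hK⟩ := ihs heV.1
    obtain ⟨L, hL⟩ := iht heV.2
    exact ⟨K ⊔ L, fun e' he' => ⟨hK (apply_eq_of_le le_sup_left he'),
      hL (apply_eq_of_le le_sup_right he')⟩⟩
  | sUnion S _ ih =>
    obtain ⟨s, hs, hes⟩ := heV
    obtain ⟨K, hK⟩ := ih s hs hes
    exact ⟨K, hK.trans (subset_sUnion_of_mem hs)⟩

theorem continuous_of_preimage {Y : Type*} [TopologicalSpace Y] {f : Y → EndSpace X}
    (h : ∀ (K : Compacts X) (U : Set X), IsOpen {y | (f y).1 K = U}) : Continuous f := by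
  refine continuous_generateFrom_iff.2 ?_
  rintro _ ⟨K, U, rfl⟩
  exact h K U

/-- The action of a homeomorphism on ends. -/
def mapFun (f : X ≃ₜ X) (e : EndSpace X) : EndSpace X :=
  ⟨fun K => f '' e.1 (K.map f.symm f.symm.continuous), by
    constructor
    · intro K
      obtain ⟨x, hx, h⟩ := e.2.1 (K.map f.symm f.symm.continuous)
      have himg : f '' (K.map f.symm f.symm.continuous : Compacts X)ᶜ = (K : Set X)ᶜ := by
        rw [image_compl_eq f.bijective, Compacts.coe_map, ← image_comp]
        simp
      refine ⟨f x, himg ▸ mem_image_of_mem f hx, ?_⟩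
      exact (congrArg (f '' ·) h).trans ((f.image_connectedComponentIn hx).trans (by rw [himg]))
    · intro K L hKL
      exact image_mono (e.2.2 _ _ (image_mono hKL))⟩

theorem mapFun_symm_mapFun (f : X ≃ₜ X) (e : EndSpace X) : mapFun f.symm (mapFun f e) = e := by
  apply Subtype.ext
  funext K
  have hK : (K.map f f.continuous).map f.symm f.symm.continuous = K := by
    ext x; simp
  change f.symm '' (f '' e.1 ((K.map f.symm.symm f.symm.symm.continuous).map f.symm _)) = _
  rw [← image_comp]
  simp only [Homeomorph.symm_symm, hK]
  simp

theorem continuous_mapFun (f : X ≃ₜ X) : Continuous (mapFun f) := by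
  refine continuous_of_preimage fun K U => ?_
  convert isOpen_setOf_apply_eq (K.map f.symm f.symm.continuous) (f ⁻¹' U) using 1
  ext e
  change f '' _ = U ↔ _ = f ⁻¹' U
  constructor
  · rintro rfl; exact (preimage_image_eq _ f.injective).symm
  · intro h; rw [h, image_preimage_eq _ f.surjective]

/-- The homeomorphism of the space of ends induced by a homeomorphism. -/
def map (f : X ≃ₜ X) : EndSpace X ≃ₜ EndSpace X where
  toFun := mapFun f
  invFun := mapFun f.symm
  left_inv := mapFun_symm_mapFun f
  right_inv := mapFun_symm_mapFun f.symm
  continuous_toFun := continuous_mapFun f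
  continuous_invFun := continuous_mapFun f.symm

theorem hasGenus_image (f : X ≃ₜ X) {U : Set X} (h : HasGenus U) : HasGenus (f '' U) := by
  obtain ⟨γ, hγ, hinj, hU, hconn⟩ := h
  refine ⟨f ∘ γ, f.continuous.comp hγ, f.injective.comp hinj, ?_, ?_⟩
  · rw [range_comp]; exact image_mono hU
  · rw [range_comp, ← image_sdiff f.injective]
    exact hconn.image f f.continuous.continuousOn

theorem map_mem_genusEnds (f : X ≃ₜ X) (h : e ∈ genusEnds X) : map f e ∈ genusEnds X :=
  fun K => hasGenus_image f (h (K.map f.symm f.symm.continuous))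

theorem mem_genusEnds_iff_map (f : X ≃ₜ X) : e ∈ genusEnds X ↔ map f e ∈ genusEnds X :=
  ⟨map_mem_genusEnds f, fun h => by
    have := map_mem_genusEnds f.symm h
    rwa [show map f.symm (map f e) = e from mapFun_symm_mapFun f e] at this⟩

end Basic

section Surface

variable {X : Type*} [TopologicalSpace X] [T2Space X] [ConnectedSpace X]
  [SecondCountableTopology X] [ChartedSpace Plane X] [IsManifold (𝓡 2) ∞ X]

theorem exists_le_finite_components (K : Compacts X) : ∃ L : Compacts X, K ≤ L ∧
    {Q | ∃ x ∉ L, Q = connectedComponentIn (L : Set X)ᶜ x}.Finite := by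
  have : LocallyConnectedSpace X := ChartedSpace.locallyConnectedSpace Plane X
  obtain ⟨L, hL, hLc, hLh, hKL⟩ := exists_isConnected_locallyHalfPlane K.isCompact
  exact ⟨⟨L, hL⟩, hKL, hLh.finite_components hL hLc.nonempty⟩

/-- The complement of `K` itself may have infinitely many components. A larger compact set with
half-plane boundary has finitely many, and the component there determines the one at `K`. -/
theorem finite_range_apply (K : Compacts X) : (range fun e : EndSpace X => e.1 K).Finite := by
  obtain ⟨L, hKL, hL⟩ := exists_le_finite_components K
  have : (range fun e : EndSpace X => e.1 L).Finite := by
    refine hL.subset ?_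
    rintro _ ⟨e, rfl⟩
    obtain ⟨x, hx, h⟩ := e.2.1 L
    exact ⟨x, hx, h⟩
  have h2 : ∀ U ∈ range fun e : EndSpace X => e.1 L, ∃ V, ∀ e : EndSpace X, e.1 L = U → e.1 K = V := by
    rintro _ ⟨e, rfl⟩
    exact ⟨e.1 K, fun e' he' => apply_eq_of_le hKL he'⟩
  choose! V hV using h2
  refine (this.image V).subset ?_
  rintro _ ⟨e, rfl⟩
  exact ⟨e.1 L, ⟨e, rfl⟩, (hV _ ⟨e, rfl⟩ e rfl).symm⟩

/-- At each compact set an ultrafilter selects one of finitely many components; the selections are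
compatible and form its limit. -/
instance : CompactSpace (EndSpace X) := by
  refine ⟨isCompact_iff_ultrafilter_le_nhds.2 fun f _ => ?_⟩
  have hex : ∀ K : Compacts X, ∃ U, {e : EndSpace X | e.1 K = U} ∈ f := by
    intro K
    have h := (Ultrafilter.finite_biUnion_mem_iff (f := f) (finite_range_apply K)
      (s := fun U => {e : EndSpace X | e.1 K = U})).1 (by
        refine Filter.mem_of_superset Filter.univ_mem fun e _ => ?_
        exact mem_iUnion₂.2 ⟨e.1 K, ⟨e, rfl⟩, rfl⟩)
    obtain ⟨U, -, hU⟩ := h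
    exact ⟨U, hU⟩
  choose U hU using hex
  refine ⟨⟨U, fun K => ?_, fun K L hKL => ?_⟩, mem_univ _, ?_⟩
  · obtain ⟨e, he⟩ := f.nonempty_of_mem (hU K)
    exact (he : e.1 K = U K) ▸ e.2.1 K
  · obtain ⟨e, he, he'⟩ := f.nonempty_of_mem (Filter.inter_mem (hU K) (hU L))
    rw [← (he : e.1 K = U K), ← (he' : e.1 L = U L)]
    exact e.2.2 K L hKL
  · intro s hs
    obtain ⟨K, hK⟩ := exists_subset_of_mem_nhds hs
    exact Filter.mem_of_superset (hU K) hK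

instance : SecondCountableTopology (EndSpace X) := by
  have : LocallyCompactSpace X := ChartedSpace.locallyCompactSpace Plane X
  let K : CompactExhaustion X := default
  let Kc : ℕ → Compacts X := fun n => ⟨K n, K.isCompact n⟩
  refine ⟨⋃ n, (fun U => {e : EndSpace X | e.1 (Kc n) = U}) '' (range fun e : EndSpace X => e.1 (Kc n)),
    countable_iUnion fun n => ((finite_range_apply (Kc n)).image _).countable, ?_⟩
  apply le_antisymm
  · apply le_generateFrom
    intro s hs
    obtain ⟨n, U, -, rfl⟩ := mem_iUnion.1 hs
    exact isOpen_setOf_apply_eq _ _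
  · apply le_generateFrom
    rintro _ ⟨L, U, rfl⟩
    obtain ⟨n, hn⟩ := K.exists_superset_of_isCompact L.isCompact
    have : {e : EndSpace X | e.1 L = U} = ⋃ e' ∈ {e' : EndSpace X | e'.1 L = U},
        {e : EndSpace X | e.1 (Kc n) = e'.1 (Kc n)} := by
      ext e
      simp only [mem_ofPred_eq, mem_iUnion, exists_prop]
      exact ⟨fun h => ⟨e, h, rfl⟩, fun ⟨e', h, h'⟩ => (apply_eq_of_le hn h').trans h⟩
    rw [this]
    refine @isOpen_biUnion _ _ (generateFrom _) _ _ fun e' _ => ?_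
    exact isOpen_generateFrom_of_mem (mem_iUnion.2 ⟨n, _, ⟨e', rfl⟩, rfl⟩)

/-- An ultrafilter finer than the cocompact filter selects a component of the complement of each
compact set; any two selections meet, which makes them compatible. -/
theorem nonempty_of_noncompactSpace [NoncompactSpace X] : Nonempty (EndSpace X) := by
  have : LocallyConnectedSpace X := ChartedSpace.locallyConnectedSpace Plane X
  let f : Ultrafilter X := Ultrafilter.of (Filter.cocompact X)
  have hf : ∀ K : Compacts X, (K : Set X)ᶜ ∈ f := fun K =>
    Ultrafilter.of_le _ K.isCompact.compl_mem_cocompact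
  have hex : ∀ K : Compacts X, ∃ x ∈ (K : Set X)ᶜ, connectedComponentIn (K : Set X)ᶜ x ∈ f := by
    intro K
    obtain ⟨L, hKL, hL⟩ := exists_le_finite_components K
    have h := (Ultrafilter.finite_sUnion_mem_iff (f := f) hL).1
      (Filter.mem_of_superset (hf L) fun x hx =>
        ⟨_, ⟨x, hx, rfl⟩, mem_connectedComponentIn hx⟩)
    obtain ⟨_, ⟨x, hx, rfl⟩, h⟩ := h
    exact ⟨x, fun h => hx (hKL h), Filter.mem_of_superset h
      (connectedComponentIn_mono x (compl_subset_compl.2 hKL))⟩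
  choose x hx hxf using hex
  refine ⟨⟨fun K => connectedComponentIn (K : Set X)ᶜ (x K), fun K => ⟨x K, hx K, rfl⟩,
    fun K L hKL => ?_⟩⟩
  obtain ⟨y, hyK, hyL⟩ := f.nonempty_of_mem (Filter.inter_mem (hxf K) (hxf L))
  change connectedComponentIn _ _ ⊆ connectedComponentIn _ _
  rw [connectedComponentIn_eq hyK, connectedComponentIn_eq hyL]
  exact connectedComponentIn_mono y (compl_subset_compl.2 hKL)

end Surface

end EndSpace

end Surf

/-! ### From displaced subsurfaces to covers of the end space. -/

namespace Surf
open Set Metric TopologicalSpace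

section Displacing

variable {X : Type*} [TopologicalSpace X]

/-- An end that avoids `Q` must leave the compact disc. -/
theorem EndSpace.compl_not_subset_range_disc [T2Space X] {K : Compacts X} {Q : Set X}
    (hQ : ∀ e : EndSpace X, e.1 K ≠ Q → e.1 K ⊆ Qᶜ) {e : EndSpace X} (he : e.1 K ≠ Q)
    {d : Disc → X} (hd : Topology.IsClosedEmbedding d) : ¬ Qᶜ ⊆ range d := by
  intro h
  have : CompactSpace Disc := compactSpace_disc
  let L : Compacts X := ⟨range d, isCompact_range hd.continuous⟩
  obtain ⟨x, hx⟩ := e.nonempty_apply (K ⊔ L)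
  exact e.apply_subset_compl L (e.apply_mono le_sup_right hx)
    (h (hQ e he (e.apply_mono le_sup_left hx)))

theorem PuncturedDisc.isCompact_setOf_le_norm {ε : ℝ} (hε : 0 < ε) :
    IsCompact {z : PuncturedDisc | ε ≤ ‖(z : ℂ)‖} := by
  refine Topology.IsInducing.subtypeVal.isCompact_iff.2 ?_
  have himg : Subtype.val '' {z : PuncturedDisc | ε ≤ ‖(z : ℂ)‖} =
      closedBall (0 : ℂ) 1 ∩ {z | ε ≤ ‖z‖} := by
    ext z
    rw [mem_inter_iff, mem_closedBall_zero_iff]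
    constructor
    · rintro ⟨w, hw, rfl⟩
      exact ⟨w.2.2, hw⟩
    · rintro ⟨h1, h2⟩
      exact ⟨⟨z, norm_pos_iff.1 (hε.trans_le h2), h1⟩, h2, rfl⟩
  exact himg ▸ (isCompact_closedBall (0 : ℂ) 1).inter_right
    (isClosed_le continuous_const continuous_norm)

/-- A punctured disc has room for one end: near the puncture it is connected and misses `K`, so all
ends that avoid `Q` would share one component of the complement of `K`. -/
theorem EndSpace.compl_not_subset_range_puncturedDisc [T2Space X] {K : Compacts X} {Q : Set X}
    (hQ : ∀ e : EndSpace X, e.1 K ≠ Q → e.1 K ⊆ Qᶜ) {e e' : EndSpace X} (he : e.1 K ≠ Q)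
    (he' : e'.1 K ≠ Q) (hne : e.1 K ≠ e'.1 K)
    {d : PuncturedDisc → X} (hd : Topology.IsClosedEmbedding d) : ¬ Qᶜ ⊆ range d := by
  intro h
  have hpre : IsCompact (d ⁻¹' K) := hd.isCompact_preimage K.isCompact
  obtain ⟨ε, hε, hε1, hεK⟩ : ∃ ε > 0, ε ≤ (1 : ℝ) ∧ ∀ z, d z ∈ K → ε ≤ ‖(z : ℂ)‖ := by
    obtain ⟨ε, hε, h⟩ := hpre.exists_forall_le' (f := fun z : PuncturedDisc => ‖(z : ℂ)‖) (a := 0)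
      (by fun_prop) fun z _ => norm_pos_iff.2 z.2.1
    exact ⟨min ε 1, by positivity, min_le_right _ _, fun z hz => (min_le_left _ _).trans (h z hz)⟩
  let L : Compacts X := ⟨d '' {z | ε ≤ ‖(z : ℂ)‖},
    (PuncturedDisc.isCompact_setOf_le_norm hε).image hd.continuous⟩
  let N : Set X := d '' {z | (z : ℂ) ∈ {z : ℂ | z ≠ 0 ∧ ‖z‖ < ε}}
  have hN : IsConnected N := isConnected_image_subtype hd.continuous
    (isConnected_punctured_ball hε) fun z hz => ⟨hz.1, hz.2.le.trans hε1⟩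
  have hNK : N ⊆ (K : Set X)ᶜ := by
    rintro _ ⟨z, hz, rfl⟩ hzK
    exact absurd (hεK z hzK) (not_le.2 hz.2)
  have key : ∀ e : EndSpace X, e.1 K ≠ Q → N ⊆ e.1 K := by
    intro e he
    refine EndSpace.subset_apply hN.isPreconnected hNK ?_
    obtain ⟨x, hx⟩ := e.nonempty_apply (K ⊔ L)
    have hxK := e.apply_mono le_sup_left hx
    obtain ⟨z, rfl⟩ := h (hQ e he hxK)
    refine ⟨d z, ⟨z, ⟨z.2.1, not_le.1 fun hz => ?_⟩, rfl⟩, hxK⟩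
    exact e.apply_subset_compl L (e.apply_mono le_sup_right hx) ⟨z, hz, rfl⟩
  obtain ⟨x, hx⟩ := hN.nonempty
  exact hne (EndSpace.apply_eq_of_nonempty ⟨x, key e he hx, key e' he' hx⟩)

/-- A compact `X` would be a nondisplaceable subsurface of itself, with no boundary and no
punctures. -/
theorem noncompactSpace_of_noNondisplaceable [ConnectedSpace X]
    (hX : NoNondisplaceableSubsurface X) :
    NoncompactSpace X := by
  rw [← not_compactSpace_iff]
  intro h
  refine hX univ ⟨isClosed_univ, isConnected_univ, by simp⟩ ⟨0, Fin.elim0, fun i => i.elim0,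
    fun i => i.elim0, ?_⟩ (by simp [IsEssential]) fun f => by simp
  simpa using isCompact_univ

variable [T2Space X] [ConnectedSpace X]
  [SecondCountableTopology X] [ChartedSpace Plane X] [IsManifold (𝓡 2) ∞ X]

/-- The analogue of a Lebesgue number: a compact set so large that each of its complementary
components cuts out a small set of ends. -/
theorem EndSpace.exists_forall_setOf_apply_eq_subset {U : EndSpace X → Set (EndSpace X)}
    (hU : ∀ e, U e ∈ nhds e) : ∃ K : Compacts X, ∀ L, K ≤ L → ∀ e : EndSpace X,
      ∃ e', {e'' | e''.1 L = e.1 L} ⊆ U e' := by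
  choose K hK using fun e => exists_subset_of_mem_nhds (hU e)
  obtain ⟨t, ht⟩ := isCompact_univ.elim_finite_subcover
    (fun e : EndSpace X => {e' : EndSpace X | e'.1 (K e) = e.1 (K e)})
    (fun e => isOpen_setOf_apply_eq _ _) fun e _ => mem_iUnion.2 ⟨e, rfl⟩
  refine ⟨t.sup K, fun L hL e => ?_⟩
  obtain ⟨e', he', h⟩ := mem_iUnion₂.1 (ht (mem_univ e))
  refine ⟨e', fun e'' he'' => hK e' ?_⟩
  exact (apply_eq_of_le ((Finset.le_sup he').trans hL) he'').trans h

/-- If no finite type subsurface is nondisplaceable then, for each neighbourhood assignment on a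
space of at least three ends, a homeomorphism moves the complement of a small set into a small
set. -/
theorem exists_homeo_cover_of_noNondisplaceable (hX : NoNondisplaceableSubsurface X)
    {e₁ e₂ e₃ : EndSpace X} (h12 : e₁ ≠ e₂) (h13 : e₁ ≠ e₃) (h23 : e₂ ≠ e₃)
    {U : EndSpace X → Set (EndSpace X)} (hU : ∀ e, U e ∈ nhds e) :
    ∃ (h : EndSpace X ≃ₜ EndSpace X) (C C' : Set (EndSpace X)),
      (∀ e, e ∈ genusEnds X ↔ h e ∈ genusEnds X) ∧ IsClopen C ∧ IsClopen C' ∧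
      (∃ e, C ⊆ U e) ∧ (∃ e, C' ⊆ U e) ∧ ∀ e, e ∈ C ∨ e ∈ h '' C' := by
  have : LocallyConnectedSpace X := ChartedSpace.locallyConnectedSpace Plane X
  obtain ⟨K₀, hK₀⟩ := EndSpace.exists_forall_setOf_apply_eq_subset hU
  obtain ⟨K₁, hK₁⟩ := EndSpace.exists_apply_ne h12
  obtain ⟨K₂, hK₂⟩ := EndSpace.exists_apply_ne h13
  obtain ⟨K₃, hK₃⟩ := EndSpace.exists_apply_ne h23
  obtain ⟨K', hK'c, hKconn, hKh, hle⟩ := exists_isConnected_locallyHalfPlane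
    (K₀ ⊔ K₁ ⊔ K₂ ⊔ K₃).isCompact
  let K : Compacts X := ⟨K', hK'c⟩
  have hleK : K₀ ⊔ K₁ ⊔ K₂ ⊔ K₃ ≤ K := hle
  have hd12 : e₁.1 K ≠ e₂.1 K := fun h => hK₁ (EndSpace.apply_eq_of_le
    ((le_sup_right.trans (le_sup_left.trans le_sup_left)).trans hleK) h)
  have hd13 : e₁.1 K ≠ e₃.1 K := fun h => hK₂ (EndSpace.apply_eq_of_le
    ((le_sup_right.trans le_sup_left).trans hleK) h)
  have hd23 : e₂.1 K ≠ e₃.1 K := fun h => hK₃ (EndSpace.apply_eq_of_le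
    (le_sup_right.trans hleK) h)
  have hKcl : IsClosed K' := hK'c.isClosed
  have hcomp : ∀ q ∉ K', ∀ e : EndSpace X, e.1 K ≠ connectedComponentIn K'ᶜ q →
      e.1 K ⊆ (connectedComponentIn K'ᶜ q)ᶜ := by
    intro q hq e he x hx hxq
    exact he ((EndSpace.apply_eq_of_mem hx).trans (connectedComponentIn_eq hxq).symm)
  -- Three separated ends leave two after discarding one region, which is what excludes punctured
  -- discs.
  have htwo : ∀ Q : Set X, ∃ e e' : EndSpace X, e.1 K ≠ Q ∧ e'.1 K ≠ Q ∧ e.1 K ≠ e'.1 K := by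
    intro Q
    by_cases h1 : e₁.1 K = Q
    · exact ⟨e₂, e₃, fun h => hd12 (h1.trans h.symm), fun h => hd13 (h1.trans h.symm), hd23⟩
    · by_cases h2 : e₂.1 K = Q
      · exact ⟨e₁, e₃, h1, fun h => hd23 (h2.trans h.symm), hd13⟩
      · exact ⟨e₁, e₂, h1, h2, hd12⟩
  have hess : IsEssential (fill K') := by
    refine IsEssential.fill hKh hKcl hKconn (fun q hq d hd => ?_) (fun q hq d hd => ?_)
    · obtain ⟨e, -, he, -, -⟩ := htwo (connectedComponentIn K'ᶜ q)
      exact EndSpace.compl_not_subset_range_disc (K := K) (hcomp q hq) he hd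
    · obtain ⟨e, e', he, he', hne⟩ := htwo (connectedComponentIn K'ᶜ q)
      exact EndSpace.compl_not_subset_range_puncturedDisc (K := K) (hcomp q hq) he he' hne hd
  have hsub := IsSubsurface.fill hKh hKcl hKconn
  have hnd := hX _ hsub (IsFiniteType.fill hKh hK'c hKconn.nonempty) hess
  simp only [Nondisplaceable, not_forall] at hnd
  obtain ⟨f, hf⟩ := hnd
  obtain ⟨p, hp, q, hq, hcov⟩ := exists_components_cover_of_disjoint_image hsub.1 hsub.2.1 f hf
  rw [show connectedComponentIn (fill K')ᶜ p = connectedComponentIn K'ᶜ p from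
      connectedComponentIn_compl_union_components _ hp,
    show connectedComponentIn (fill K')ᶜ q = connectedComponentIn K'ᶜ q from
      connectedComponentIn_compl_union_components _ hq] at hcov
  have hsmall : ∀ Q : Set X, ∃ e, {e' : EndSpace X | e'.1 K = Q} ⊆ U e := by
    intro Q
    by_cases h : ∃ e : EndSpace X, e.1 K = Q
    · obtain ⟨e, rfl⟩ := h
      exact hK₀ K ((le_sup_left.trans (le_sup_left.trans le_sup_left)).trans hleK) e
    · exact ⟨e₁, fun e he => absurd ⟨e, he⟩ h⟩
  refine ⟨EndSpace.map f, _, _, fun e => EndSpace.mem_genusEnds_iff_map f,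
    EndSpace.isClopen_setOf_apply_eq K (connectedComponentIn K'ᶜ p),
    EndSpace.isClopen_setOf_apply_eq K (connectedComponentIn K'ᶜ q), hsmall _, hsmall _,
    fun e => ?_⟩
  by_cases hep : e.1 K = connectedComponentIn K'ᶜ p
  · exact Or.inl hep
  right
  refine ⟨(EndSpace.map f).symm e, ?_, (EndSpace.map f).apply_symm_apply e⟩
  change f.symm '' e.1 (K.map f.symm.symm f.symm.symm.continuous) = _
  set L := K.map f.symm.symm f.symm.symm.continuous
  -- A point far out towards `e` lies outside the component of `p`, so its preimage lies in that of
  -- `q`; this identifies the component of the pulled-back end.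
  obtain ⟨x, hx⟩ := e.nonempty_apply (K ⊔ L)
  have hxK := e.apply_mono le_sup_left hx
  have hxL := e.apply_mono le_sup_right hx
  have hfx : f.symm x ∈ connectedComponentIn K'ᶜ q := by
    rcases hcov x with h | ⟨y, hy, rfl⟩
    · exact absurd h (hcomp p (fun h => hp (Or.inl h)) e hep hxK)
    · simpa using hy
  have h1 : ((EndSpace.map f.symm e).1 K) = f.symm '' e.1 L := rfl
  rw [← h1, connectedComponentIn_eq hfx]
  exact EndSpace.apply_eq_of_mem (h1 ▸ mem_image_of_mem f.symm hxL)

end Displacing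

end Surf

/-! ### Clopen copies and the preorder on points. -/

namespace Surf
open Set

section Copies

variable {E : Type*} [TopologicalSpace E] {G A B U V : Set E} {x y z : E}

theorem PairHomeo.refl (G A : Set E) : PairHomeo G A A := ⟨Homeomorph.refl A, fun _ => Iff.rfl⟩

theorem PairHomeo.symm (h : PairHomeo G A B) : PairHomeo G B A := by
  obtain ⟨f, hf⟩ := h
  exact ⟨f.symm, fun b => by simpa using (hf (f.symm b)).symm⟩

theorem PairHomeo.trans {C : Set E} (h : PairHomeo G A B) (h' : PairHomeo G B C) :
    PairHomeo G A C := by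
  obtain ⟨f, hf⟩ := h
  obtain ⟨g, hg⟩ := h'
  exact ⟨f.trans g, fun a => (hf a).trans (hg _)⟩

/-- Self-maps of `E` are easier to restrict, compose and glue than homeomorphisms of subtypes;
compactness makes the inverse continuous. -/
theorem pairHomeo_iff [T2Space E] (hA : IsCompact A) : PairHomeo G A B ↔
    ∃ f : E → E, ContinuousOn f A ∧ InjOn f A ∧ f '' A = B ∧ ∀ a ∈ A, (a ∈ G ↔ f a ∈ G) := by
  classical
  constructor
  · rintro ⟨h, hG⟩
    have hf : ∀ a (ha : a ∈ A), (if ha : a ∈ A then (h ⟨a, ha⟩ : E) else a) = h ⟨a, ha⟩ :=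
      fun a ha => dif_pos ha
    refine ⟨fun a => if ha : a ∈ A then (h ⟨a, ha⟩ : E) else a, ?_, ?_, ?_, ?_⟩
    · rw [continuousOn_iff_continuous_domRestrict]
      convert continuous_subtype_val.comp h.continuous using 1
      funext a
      exact hf a a.2
    · intro a ha b hb hab
      simp only [hf a ha, hf b hb] at hab
      exact congrArg Subtype.val (h.injective (Subtype.ext hab))
    · ext b
      constructor
      · rintro ⟨a, ha, rfl⟩
        simp only [hf a ha]
        exact (h ⟨a, ha⟩).2
      · intro hb
        refine ⟨h.symm ⟨b, hb⟩, (h.symm ⟨b, hb⟩).2, ?_⟩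
        simp
    · intro a ha
      simp only [hf a ha]
      exact hG ⟨a, ha⟩
  · rintro ⟨f, hc, hinj, rfl, hG⟩
    have : CompactSpace A := isCompact_iff_compactSpace.1 hA
    have hcont : Continuous (Equiv.Set.imageOfInjOn f A hinj) :=
      (continuousOn_iff_continuous_domRestrict.1 hc).subtype_mk _
    exact ⟨hcont.homeoOfEquivCompactToT2, fun a => hG a a.2⟩

/-- `A` is homeomorphic, as a pair, to a clopen subset of `U`. -/
def HasCopyIn (G A U : Set E) : Prop := ∃ W, IsClopen W ∧ W ⊆ U ∧ PairHomeo G A W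

theorem HasCopyIn.refl (hA : IsClopen A) (hAU : A ⊆ U) : HasCopyIn G A U :=
  ⟨A, hA, hAU, PairHomeo.refl G A⟩

theorem below_iff : Below G x y ↔
    ∀ U : Set E, IsClopen U → y ∈ U → ∃ V, IsClopen V ∧ x ∈ V ∧ HasCopyIn G V U := by
  refine forall₃_congr fun U hU hy => ?_
  constructor
  · rintro ⟨V, W, hV, hx, hW, hWU, h⟩
    exact ⟨V, hV, hx, W, hW, hWU, h⟩
  · rintro ⟨V, hV, hx, W, hW, hWU, h⟩
    exact ⟨V, W, hV, hx, hW, hWU, h⟩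

theorem Below.refl (G : Set E) (x : E) : Below G x x :=
  below_iff.2 fun U hU hx => ⟨U, hU, hx, HasCopyIn.refl hU Subset.rfl⟩

theorem isClosed_setOf_below (G : Set E) (x : E) : IsClosed {y | Below G x y} := by
  rw [← isOpen_compl_iff, isOpen_iff_mem_nhds]
  intro y hy
  simp only [mem_compl_iff, mem_ofPred_eq, below_iff, not_forall] at hy
  obtain ⟨U, hU, hyU, h⟩ := hy
  refine Filter.mem_of_superset (hU.isOpen.mem_nhds hyU) fun z hz hzB => h ?_
  exact below_iff.1 hzB U hU hz

variable [CompactSpace E] [T2Space E]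

/-- The image of `B` is compact, and it is open as the image of `A` minus the compact image of `A \
B`. -/
theorem isClopen_image {f : E → E} (hA : IsClopen A) (hB : IsClopen B) (hBA : B ⊆ A)
    (hf : ContinuousOn f A) (hinj : InjOn f A) (hfA : IsClopen (f '' A)) : IsClopen (f '' B) := by
  refine ⟨(hB.isClosed.isCompact.image_of_continuousOn (hf.mono hBA)).isClosed, ?_⟩
  have : f '' B = f '' A \ f '' (A \ B) := by
    rw [← hinj.image_sdiff_subset sdiff_subset, sdiff_sdiff_cancel_left hBA]
  rw [this]
  exact hfA.isOpen.sdiff ((hA.isClosed.sdiff hB.isOpen).isCompact.image_of_continuousOn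
    (hf.mono sdiff_subset)).isClosed

theorem hasCopyIn_iff (hA : IsClopen A) : HasCopyIn G A U ↔
    ∃ f : E → E, ContinuousOn f A ∧ InjOn f A ∧ MapsTo f A U ∧ IsClopen (f '' A) ∧
      ∀ a ∈ A, (a ∈ G ↔ f a ∈ G) := by
  constructor
  · rintro ⟨W, hW, hWU, h⟩
    obtain ⟨f, hc, hi, rfl, hG⟩ := (pairHomeo_iff hA.isClosed.isCompact).1 h
    exact ⟨f, hc, hi, fun a ha => hWU ⟨a, ha, rfl⟩, hW, hG⟩
  · rintro ⟨f, hc, hi, hm, hcl, hG⟩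
    exact ⟨f '' A, hcl, hm.image_subset,
      (pairHomeo_iff hA.isClosed.isCompact).2 ⟨f, hc, hi, rfl, hG⟩⟩

theorem HasCopyIn.mono_left (hA : IsClopen A) (h : HasCopyIn G A U) (hB : IsClopen B)
    (hBA : B ⊆ A) : HasCopyIn G B U := by
  obtain ⟨f, hc, hi, hm, hcl, hG⟩ := (hasCopyIn_iff hA).1 h
  exact (hasCopyIn_iff hB).2 ⟨f, hc.mono hBA, hi.mono hBA, hm.mono_left hBA,
    isClopen_image hA hB hBA hc hi hcl, fun a ha => hG a (hBA ha)⟩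

theorem HasCopyIn.trans (hA : IsClopen A) (hU : IsClopen U) (h : HasCopyIn G A U)
    (h' : HasCopyIn G U V) : HasCopyIn G A V := by
  obtain ⟨f, hc, hi, hm, hcl, hG⟩ := (hasCopyIn_iff hA).1 h
  obtain ⟨g, hc', hi', hm', hcl', hG'⟩ := (hasCopyIn_iff hU).1 h'
  refine (hasCopyIn_iff hA).2 ⟨g ∘ f, hc'.comp hc hm, hi'.comp hi hm, hm'.comp hm, ?_,
    fun a ha => (hG a ha).trans (hG' _ (hm ha))⟩
  rw [image_comp]
  exact isClopen_image hU hcl hm.image_subset hc' hi' hcl'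

theorem HasCopyIn.union (hA : IsClopen A) (hB : IsClopen B) (hAB : Disjoint A B)
    (hUV : Disjoint U V) (h : HasCopyIn G A U) (h' : HasCopyIn G B V) :
    HasCopyIn G (A ∪ B) (U ∪ V) := by
  classical
  obtain ⟨f, hc, hi, hm, hcl, hG⟩ := (hasCopyIn_iff hA).1 h
  obtain ⟨g, hc', hi', hm', hcl', hG'⟩ := (hasCopyIn_iff hB).1 h'
  have hf : EqOn (A.piecewise f g) f A := fun a ha => piecewise_eq_of_mem A f g ha
  have hg : EqOn (A.piecewise f g) g B := fun a ha =>
    piecewise_eq_of_notMem A f g (disjoint_right.1 hAB ha)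
  refine (hasCopyIn_iff (hA.union hB)).2 ⟨A.piecewise f g, ?_, ?_, ?_, ?_, ?_⟩
  · exact (hc.congr hf).union_of_isClosed (hc'.congr hg) hA.isClosed hB.isClosed
  · refine (injOn_union hAB).2 ⟨hi.congr hf.symm, hi'.congr hg.symm, fun a ha b hb hab => ?_⟩
    rw [hf ha, hg hb] at hab
    exact disjoint_left.1 hUV (hm ha) (hab ▸ hm' hb)
  · exact (hm.congr hf.symm).union_union (hm'.congr hg.symm)
  · rw [image_union, hf.image_eq, hg.image_eq]
    exact hcl.union hcl'
  · rintro a (ha | ha)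
    · rw [hf ha]; exact hG a ha
    · rw [hg ha]; exact hG' a ha

theorem HasCopyIn.of_homeomorph (hA : IsClopen A) (h : E ≃ₜ E) (hG : ∀ e, e ∈ G ↔ h e ∈ G)
    (hAU : h '' A ⊆ U) : HasCopyIn G A U :=
  (hasCopyIn_iff hA).2 ⟨h, h.continuous.continuousOn, h.injective.injOn,
    fun a ha => hAU ⟨a, ha, rfl⟩, ⟨h.isClosed_image.2 hA.isClosed, h.isOpen_image.2 hA.isOpen⟩, fun a _ => hG a⟩

theorem Below.trans (h : Below G x y) (h' : Below G y z) : Below G x z := by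
  rw [below_iff] at *
  intro U hU hz
  obtain ⟨V, hV, hy, hVU⟩ := h' U hU hz
  obtain ⟨W, hW, hx, hWV⟩ := h V hV hy
  exact ⟨W, hW, hx, hWV.trans hW hV hVU⟩

/-- Zorn's lemma: the sets of points above the members of a chain are nonempty, nested and closed,
so by compactness they have a common point, an upper bound. -/
theorem exists_maximal_above (G : Set E) (x : E) : ∃ m ∈ maximalPoints G, Below G x m := by
  obtain ⟨m, hm⟩ := exists_maximal_of_chains_bounded
    (r := fun a b : {y // Below G x y} => Below G a.1 b.1) (fun c hc => by
      rcases c.eq_empty_or_nonempty with rfl | hne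
      · exact ⟨⟨x, Below.refl G x⟩, by simp⟩
      · have : Nonempty c := hne.to_subtype
        have : Std.Refl fun a b : {y // Below G x y} => Below G a.1 b.1 :=
          ⟨fun a => Below.refl G a.1⟩
        obtain ⟨u, hu⟩ := IsCompact.nonempty_iInter_of_directed_nonempty_isCompact_isClosed
          (fun a : c => {y | Below G a.1.1 y}) (fun a b => by
            rcases hc.total a.2 b.2 with h | h
            · exact ⟨b, fun y hy => h.trans hy, fun y hy => hy⟩
            · exact ⟨a, fun y hy => hy, fun y hy => h.trans hy⟩)
          (fun a => ⟨_, Below.refl G _⟩) (fun a => (isClosed_setOf_below G _).isCompact)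
          (fun a => isClosed_setOf_below G _)
        rw [mem_iInter] at hu
        obtain ⟨a, ha⟩ := hne
        exact ⟨⟨u, a.2.trans (hu ⟨a, ha⟩)⟩, fun b hb => hu ⟨b, hb⟩⟩)
    (fun h h' => h.trans h')
  exact ⟨m.1, fun y hy => hm ⟨y, m.2.trans hy⟩ hy, m.2⟩

end Copies

end Surf

/-! ### Brouwer's characterization of the Cantor set. -/

namespace Surf
open Set

section Cantor

variable {Y : Type*} [TopologicalSpace Y] [CompactSpace Y] [T2Space Y]
  [TotallyDisconnectedSpace Y]

/-- For each pair from a countable basis a clopen set separating the two is chosen, or the empty set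
if there is none. -/
theorem exists_isClopen_seq_separating [SecondCountableTopology Y] : ∃ C : ℕ → Set Y,
    (∀ n, IsClopen (C n)) ∧ ∀ x y, x ≠ y → ∃ n, x ∈ C n ∧ y ∉ C n := by
  classical
  let B := TopologicalSpace.countableBasis Y
  have hB := TopologicalSpace.isBasis_countableBasis Y
  have hBc : Countable (B × B) := by
    have : Countable B := TopologicalSpace.countable_countableBasis Y
    infer_instance
  let P : B × B → Set Y → Prop := fun p C => IsClopen C ∧ p.1.1 ⊆ C ∧ Disjoint p.2.1 C
  let C : B × B → Set Y := fun p => if h : ∃ C, P p C then h.choose else ∅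
  have hC : ∀ p, IsClopen (C p) := by
    intro p
    by_cases h : ∃ C, P p C
    · simp only [C, dif_pos h]; exact h.choose_spec.1
    · simp only [C, dif_neg h]; exact isClopen_empty
  have hsep : ∀ x y, x ≠ y → ∃ p, x ∈ C p ∧ y ∉ C p := by
    intro x y hxy
    obtain ⟨D, hD, hxD, hDy⟩ := compact_exists_isClopen_in_isOpen isOpen_ne hxy
    have hyD : y ∉ D := fun h => hDy h rfl
    obtain ⟨b, hb, hxb, hbD⟩ := hB.exists_subset_of_mem_open hxD hD.isOpen
    obtain ⟨b', hb', hyb', hbD'⟩ := hB.exists_subset_of_mem_open (mem_compl hyD) hD.compl.isOpen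
    have h : ∃ C, P (⟨b, hb⟩, ⟨b', hb'⟩) C :=
      ⟨D, hD, hbD, disjoint_left.2 fun z hz hzD => hbD' hz hzD⟩
    refine ⟨(⟨b, hb⟩, ⟨b', hb'⟩), ?_⟩
    simp only [C, dif_pos h]
    exact ⟨h.choose_spec.2.1 hxb, disjoint_left.1 h.choose_spec.2.2 hyb'⟩
  rcases isEmpty_or_nonempty (B × B) with hE | hE
  · exact ⟨fun _ => ∅, fun _ => isClopen_empty, fun x y hxy => (hE.false (hsep x y hxy).choose).elim⟩
  · obtain ⟨e, he⟩ := exists_surjective_nat (B × B)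
    refine ⟨fun n => C (e n), fun n => hC _, fun x y hxy => ?_⟩
    obtain ⟨p, hp⟩ := hsep x y hxy
    obtain ⟨n, rfl⟩ := he p
    exact ⟨n, hp⟩

/-- In a space without isolated points, a clopen set splits into two parts that are decided by a
given clopen set. -/
theorem exists_clopen_split (hperf : ∀ U : Set Y, IsOpen U → U.Nonempty → U.Nontrivial)
    {A C : Set Y} (hA : IsClopen A) (hne : A.Nonempty) (hC : IsClopen C) :
    ∃ A₀ : Set Y, IsClopen A₀ ∧ A₀ ⊆ A ∧ A₀.Nonempty ∧ (A \ A₀).Nonempty ∧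
      (A₀ ⊆ C ∨ Disjoint A₀ C) ∧ (A \ A₀ ⊆ C ∨ Disjoint (A \ A₀) C) := by
  by_cases h : (A ∩ C).Nonempty ∧ (A \ C).Nonempty
  · refine ⟨A ∩ C, hA.inter hC, inter_subset_left, h.1, ?_, Or.inl inter_subset_right, Or.inr ?_⟩
    · rw [sdiff_self_inter]; exact h.2
    · rw [sdiff_self_inter]; exact disjoint_sdiff_left
  · have hAC : A ⊆ C ∨ Disjoint A C := by
      rw [not_and_or, not_nonempty_iff_eq_empty, not_nonempty_iff_eq_empty] at h
      exact h.symm.imp sdiff_eq_empty.1 disjoint_iff_inter_eq_empty.2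
    obtain ⟨x, hx, y, hy, hxy⟩ := hperf A hA.isOpen hne
    obtain ⟨D, hD, hxD, hDy⟩ := compact_exists_isClopen_in_isOpen isOpen_ne hxy
    exact ⟨A ∩ D, hA.inter hD, inter_subset_left, ⟨x, hx, hxD⟩,
      ⟨y, hy, fun h => hDy h.2 rfl⟩, hAC.imp inter_subset_left.trans fun h =>
        h.mono_left inter_subset_left, hAC.imp sdiff_subset.trans fun h => h.mono_left sdiff_subset⟩

/-- Brouwer's characterization of the Cantor set. -/
theorem nonempty_homeomorph_cantor [SecondCountableTopology Y] [Nonempty Y]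
    (hperf : ∀ U : Set Y, IsOpen U → U.Nonempty → U.Nontrivial) : Nonempty (Y ≃ₜ (ℕ → Bool)) := by
  obtain ⟨C, hC, hsep⟩ := exists_isClopen_seq_separating (Y := Y)
  let T := {A : Set Y // IsClopen A ∧ A.Nonempty}
  choose s hs hsA hsne hsne' hsC hsC' using fun (A : T) (n : ℕ) =>
    exists_clopen_split hperf A.2.1 A.2.2 (hC n)
  let child : T → ℕ → Bool → T := fun A n b => bif b then ⟨s A n, hs A n, hsne A n⟩
    else ⟨A.1 \ s A n, A.2.1.diff (hs A n), hsne' A n⟩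
  have hchild_sub : ∀ A n b, (child A n b).1 ⊆ A.1 := by
    rintro A n (_ | _)
    · exact sdiff_subset
    · exact hsA A n
  have hchild_dec : ∀ A n b, (child A n b).1 ⊆ C n ∨ Disjoint (child A n b).1 (C n) := by
    rintro A n (_ | _)
    · exact hsC' A n
    · exact hsC A n
  have hchild_disj : ∀ A n b b', b ≠ b' → Disjoint (child A n b).1 (child A n b').1 := by
    rintro A n (_ | _) (_ | _) h
    · exact absurd rfl h
    · exact disjoint_sdiff_left
    · exact disjoint_sdiff_right
    · exact absurd rfl h
  have hchild_cover : ∀ A n y, y ∈ A.1 → ∃ b, y ∈ (child A n b).1 := by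
    intro A n y hy
    by_cases h : y ∈ s A n
    · exact ⟨true, h⟩
    · exact ⟨false, hy, h⟩
  -- The cells of a binary tree of clopen sets. The `n`-th split decides membership in `C n`, so the
  -- cells along a branch shrink to one point.
  let cell : (ℕ → Bool) → ℕ → T := fun b n =>
    Nat.rec ⟨univ, isClopen_univ, univ_nonempty⟩ (fun n A => child A n (b n)) n
  have hsucc : ∀ b n, cell b (n + 1) = child (cell b n) n (b n) := fun b n => rfl
  have hanti : ∀ b n, (cell b (n + 1)).1 ⊆ (cell b n).1 := fun b n => hchild_sub _ _ _
  have hagree : ∀ b b' n, (∀ i < n, b i = b' i) → cell b n = cell b' n := by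
    intro b b' n
    induction n with
    | zero => intro _; rfl
    | succ n ih =>
      intro h
      rw [hsucc, hsucc, ih fun i hi => h i (by omega), h n (by omega)]
  have hF : ∀ b, ∃ y, ∀ n, y ∈ (cell b n).1 := by
    intro b
    obtain ⟨y, hy⟩ := IsCompact.nonempty_iInter_of_sequence_nonempty_isCompact_isClosed
      (fun n => (cell b n).1) (hanti b) (fun n => (cell b n).2.2)
      (cell b 0).2.1.isClosed.isCompact (fun n => (cell b n).2.1.isClosed)
    exact ⟨y, fun n => mem_iInter.1 hy n⟩
  have huniq : ∀ b y y', (∀ n, y ∈ (cell b n).1) → (∀ n, y' ∈ (cell b n).1) → y = y' := by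
    intro b y y' h h'
    by_contra hne
    obtain ⟨n, hn, hn'⟩ := hsep y y' hne
    rcases hchild_dec (cell b n) n (b n) with hc | hc
    · exact hn' (hc (h' (n + 1)))
    · exact disjoint_left.1 hc (h (n + 1)) hn
  choose F hF using hF
  have hinj : Function.Injective F := by
    intro b b' hbb
    by_contra hne
    have hex : ∃ n, b n ≠ b' n := Function.ne_iff.1 hne
    classical
    let n := Nat.find hex
    have hn : b n ≠ b' n := Nat.find_spec hex
    have hlt : cell b n = cell b' n := hagree b b' n fun i hi => not_not.1 (Nat.find_min hex hi)
    have h1 := hF b (n + 1)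
    have h2 := hF b' (n + 1)
    rw [hsucc] at h1 h2
    rw [← hlt, ← hbb] at h2
    exact disjoint_left.1 (hchild_disj _ n _ _ hn) h1 h2
  have hsurj : Function.Surjective F := by
    intro y
    -- The branch of `y` is found by always choosing a child that contains `y`.
    choose β hβ using fun (A : T) (n : ℕ) (h : y ∈ A.1) => hchild_cover A n y h
    let c : ℕ → {A : T // y ∈ A.1} := fun n =>
      Nat.rec ⟨⟨univ, isClopen_univ, univ_nonempty⟩, mem_univ y⟩
        (fun n A => ⟨child A.1 n (β A.1 n A.2), hβ A.1 n A.2⟩) n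
    let b : ℕ → Bool := fun n => β (c n).1 n (c n).2
    have hcell : ∀ n, cell b n = (c n).1 := by
      intro n
      induction n with
      | zero => rfl
      | succ n ih => rw [hsucc, ih]
    exact ⟨b, huniq b _ _ (hF b) fun n => (hcell n).symm ▸ (c n).2⟩
  have hcont : Continuous F := by
    rw [continuous_iff_continuousAt]
    intro b U hU
    have hA : Antitone fun n => (cell b n).1 := antitone_nat_of_succ_le (hanti b)
    obtain ⟨n, hn⟩ := exists_subset_nhds_of_isCompact (V := fun n => (cell b n).1)
      (fun i j => ⟨max i j, hA (le_max_left i j), hA (le_max_right i j)⟩)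
      (fun n => (cell b n).2.1.isClosed.isCompact) (U := U) (fun y hy => by
        rwa [huniq b y (F b) (fun n => mem_iInter.1 hy n) (hF b)])
    have hN : {b' : ℕ → Bool | ∀ i ∈ Finset.range n, b' i = b i} ∈ nhds b := by
      have : {b' : ℕ → Bool | ∀ i ∈ Finset.range n, b' i = b i} =
          ⋂ i ∈ Finset.range n, (fun b' : ℕ → Bool => b' i) ⁻¹' {b i} := by
        ext; simp
      rw [this, Filter.biInter_finset_mem]
      intro i _
      exact (continuous_apply i).continuousAt.preimage_mem_nhds (by simp)
    refine Filter.mem_map.2 (Filter.mem_of_superset hN fun b' hb' => hn ?_)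
    rw [hagree b b' n fun i hi => (hb' i (Finset.mem_range.2 hi)).symm]
    exact hF b' n
  exact ⟨((hcont.homeoOfEquivCompactToT2 (f := Equiv.ofBijective F ⟨hinj, hsurj⟩))).symm⟩

end Cantor

end Surf

/-! ### Universal points, and the consequences of self-similarity. -/

namespace Surf
open Set

section Universal

variable {E : Type*} [TopologicalSpace E] {G : Set E} {x y : E}

/-- Every clopen neighbourhood of `x` contains a clopen copy of the whole space. -/
def IsUniversalPoint (G : Set E) (x : E) : Prop :=
  ∀ U, IsClopen U → x ∈ U → HasCopyIn G univ U

theorem IsUniversalPoint.below (h : IsUniversalPoint G x) (y : E) : Below G y x :=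
  below_iff.2 fun U hU hx => ⟨univ, isClopen_univ, mem_univ y, h U hU hx⟩

theorem isClosed_setOf_isUniversalPoint (G : Set E) : IsClosed {x | IsUniversalPoint G x} := by
  rw [← isOpen_compl_iff, isOpen_iff_mem_nhds]
  intro y hy
  simp only [mem_compl_iff, mem_ofPred_eq, IsUniversalPoint, not_forall] at hy
  obtain ⟨U, hU, hyU, h⟩ := hy
  exact Filter.mem_of_superset (hU.isOpen.mem_nhds hyU) fun z hz hzB => h (hzB U hU hz)

variable [CompactSpace E]

/-- Otherwise finitely many clopen sets without a copy of the space would cover it; made disjoint,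
they contradict self-similarity. -/
theorem SelfSimilar.exists_isUniversalPoint [Nonempty E] (h : SelfSimilar G) :
    ∃ x, IsUniversalPoint G x := by
  by_contra! hcon
  simp only [IsUniversalPoint, not_forall] at hcon
  choose U hU hxU hbad using hcon
  obtain ⟨t, -, ht⟩ := isCompact_univ.elim_nhds_subcover U
    fun x _ => (hU x).isOpen.mem_nhds (hxU x)
  obtain ⟨n, hn⟩ : ∃ n, t.card = n + 1 := by
    refine Nat.exists_eq_succ_of_ne_zero fun h0 => ?_
    rw [Finset.card_eq_zero.1 h0] at ht
    simpa using ht (mem_univ (Classical.arbitrary E))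
  let e := t.equivFinOfCardEq hn
  let F : Fin (n + 1) → Set E := fun i => U (e.symm i)
  obtain ⟨D, hD, ⟨i, hi⟩, hDE⟩ := h n (disjointed F)
    (fun i => disjointedRec (fun {t i} ht => ht.diff (hU _)) (hU _))
    (fun i j hij => disjoint_disjointed F hij) (by
      rw [iUnion_disjointed]
      refine eq_univ_of_forall fun y => ?_
      obtain ⟨z, hz, hyz⟩ := mem_iUnion₂.1 (ht (mem_univ y))
      exact mem_iUnion.2 ⟨e ⟨z, hz⟩, by simpa [F] using hyz⟩)
  exact hbad _ ⟨D, hD, hi.trans (disjointed_subset F i), hDE.symm⟩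

variable [T2Space E]

theorem IsUniversalPoint.of_below (hx : IsUniversalPoint G x) (h : Below G x y) :
    IsUniversalPoint G y := by
  intro U hU hy
  obtain ⟨V, hV, hxV, hVU⟩ := below_iff.1 h U hU hy
  exact (hx V hV hxV).trans isClopen_univ hV hVU

theorem IsUniversalPoint.maximalPoints_eq (hx : IsUniversalPoint G x) :
    maximalPoints G = {y | IsUniversalPoint G y} :=
  Subset.antisymm (fun y hy => hx.of_below (hy x (hx.below y))) fun _ hy z _ => hy.below z

theorem IsUniversalPoint.exists_map (hx : IsUniversalPoint G x) {U : Set E} (hU : IsClopen U)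
    (hxU : x ∈ U) : ∃ f : E → E, Function.Injective f ∧
      ∀ y, IsUniversalPoint G y → f y ∈ U ∧ IsUniversalPoint G (f y) := by
  obtain ⟨f, hc, hi, hm, hcl, hG⟩ := (hasCopyIn_iff isClopen_univ).1 (hx U hU hxU)
  refine ⟨f, injOn_univ.1 hi, fun y hy => ⟨hm (mem_univ y), fun W hW hyW => ?_⟩⟩
  have hfW : IsClopen (f ⁻¹' W) := hW.preimage (continuousOn_univ.1 hc)
  -- The preimage of `W` is a neighbourhood of the universal point `y`; its copy of the space is
  -- carried into `W` by `f`.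
  refine (hy _ hfW hyW).trans isClopen_univ hfW ((hasCopyIn_iff hfW).2
    ⟨f, hc.mono (subset_univ _), hi.mono (subset_univ _), fun a ha => ha,
      isClopen_image isClopen_univ hfW (subset_univ _) hc hi hcl, fun a _ => hG a (mem_univ a)⟩)

variable [TotallyDisconnectedSpace E]

/-- Given two universal points, the copy of the space inside any neighbourhood of a universal point
carries both of them there, so no universal point is isolated among them. -/
theorem SelfSimilar.maximalPoints_singleton_or_cantor [SecondCountableTopology E] [Nonempty E]
    (h : SelfSimilar G) : (∃ x, maximalPoints G = {x}) ∨ (IsCantorSet (maximalPoints G) ∧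
      ∀ x ∈ maximalPoints G, ∀ y ∈ maximalPoints G, SameType G x y) := by
  obtain ⟨x, hx⟩ := h.exists_isUniversalPoint
  rw [hx.maximalPoints_eq]
  refine or_iff_not_imp_left.2 fun hsing => ⟨?_, fun y hy z hz => ⟨hz.below y, hy.below z⟩⟩
  have hnt : {y | IsUniversalPoint G y}.Nontrivial := by
    rw [← not_subsingleton_iff]
    exact fun hs => hsing ⟨x, hs.eq_singleton_of_mem hx⟩
  obtain ⟨y, hy, z, hz, hyz⟩ := hnt
  have : CompactSpace {y | IsUniversalPoint G y} :=
    isCompact_iff_compactSpace.1 (isClosed_setOf_isUniversalPoint G).isCompact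
  have : Nonempty {y | IsUniversalPoint G y} := ⟨⟨x, hx⟩⟩
  refine nonempty_homeomorph_cantor fun U hU ⟨w, hw⟩ => ?_
  obtain ⟨V, hV, rfl⟩ := isOpen_induced_iff.1 hU
  obtain ⟨D, hD, hwD, hDV⟩ := compact_exists_isClopen_in_isOpen hV hw
  obtain ⟨f, hf, hfD⟩ := IsUniversalPoint.exists_map w.2 hD hwD
  exact ⟨⟨f y, (hfD y hy).2⟩, hDV (hfD y hy).1, ⟨f z, (hfD z hz).2⟩, hDV (hfD z hz).1,
    fun heq => hyz (hf (congrArg Subtype.val heq))⟩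

end Universal

/-! ### Absorbing a clopen set by shifting a convergent sequence of copies. -/

section Shift

variable {E : Type*} [TopologicalSpace E] [CompactSpace E] [T2Space E] {G : Set E} {x : E}

/-- Shifting a sequence of disjoint clopen copies converging to a point absorbs the first one. -/
theorem PairHomeo.univ_compl_of_seq {W : ℕ → Set E} (hW : ∀ k, IsClopen (W k))
    (hdisj : Pairwise fun i j => Disjoint (W i) (W j))
    (hWW : ∀ k, PairHomeo G (W k) (W (k + 1))) (hx : ∀ k, x ∉ W k)
    (hconv : ∀ U ∈ nhds x, ∃ n, ∀ k ≥ n, W k ⊆ U) : PairHomeo G univ (W 0)ᶜ := by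
  classical
  choose ψ hψc hψi hψW hψG using fun k => (pairHomeo_iff (hW k).isClosed.isCompact).1 (hWW k)
  -- Each `W k` moves onto `W (k + 1)` and the rest is fixed. A point other than `x` outside all `W
  -- k` has a neighbourhood missing them; at `x` continuity is the convergence of the sequence.
  let Φ : E → E := fun e => if h : ∃ k, e ∈ W k then ψ (Nat.find h) e else e
  have hΦ : ∀ k, ∀ e ∈ W k, Φ e = ψ k e := by
    intro k e he
    have h : ∃ k, e ∈ W k := ⟨k, he⟩
    have hk : Nat.find h = k := by
      by_contra hne
      exact disjoint_left.1 (hdisj hne) (Nat.find_spec h) he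
    simp only [Φ, dif_pos h, hk]
  have hΦ' : ∀ e, (∀ k, e ∉ W k) → Φ e = e := fun e he => dif_neg (not_exists.2 he)
  have hΦW : ∀ k, ∀ e ∈ W k, Φ e ∈ W (k + 1) := by
    intro k e he
    rw [hΦ k e he, ← hψW k]
    exact ⟨e, he, rfl⟩
  have hfin : ∀ n, ∀ e, (∀ k, e ∉ W k) → ∀ᶠ e' in nhds e, ∀ k < n, e' ∉ W k := by
    intro n e he
    exact (Filter.eventually_all_finite (Set.finite_lt_nat n)).2 fun k _ =>
      (hW k).compl.isOpen.mem_nhds (he k)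
  have hcont : Continuous Φ := by
    rw [continuous_iff_continuousAt]
    intro e
    by_cases he : ∃ k, e ∈ W k
    · obtain ⟨k, hk⟩ := he
      have hn := (hW k).isOpen.mem_nhds hk
      refine ((hψc k).continuousAt hn).congr ?_
      filter_upwards [hn] with a ha using (hΦ k a ha).symm
    · push Not at he
      by_cases hex : e = x
      · subst hex
        intro U hU
        rw [hΦ' e he] at hU
        obtain ⟨n, hn⟩ := hconv U hU
        rw [Filter.mem_map]
        filter_upwards [hU, hfin n e he] with a haU ha
        by_cases h : ∃ k, a ∈ W k
        · obtain ⟨k, hk⟩ := h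
          exact hn (k + 1) (by have := not_lt.1 fun h => ha k h hk; omega) (hΦW k a hk)
        · rw [mem_preimage, hΦ' a (not_exists.1 h)]
          exact haU
      · obtain ⟨U, V, hU, hV, heU, hxV, hUV⟩ := t2_separation hex
        obtain ⟨n, hn⟩ := hconv V (hV.mem_nhds hxV)
        refine continuousAt_id.congr ?_
        filter_upwards [hU.mem_nhds heU, hfin n e he] with a haU ha
        refine (hΦ' a fun k hk => ?_).symm
        by_cases hkn : k < n
        · exact ha k hkn hk
        · exact disjoint_left.1 hUV haU (hn k (not_lt.1 hkn) hk)
  refine (pairHomeo_iff isCompact_univ).2 ⟨Φ, hcont.continuousOn, ?_, ?_, ?_⟩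
  · intro a _ b _ hab
    by_cases ha : ∃ k, a ∈ W k <;> by_cases hb : ∃ k, b ∈ W k
    · obtain ⟨k, hk⟩ := ha
      obtain ⟨l, hl⟩ := hb
      have hkl : k = l := by
        by_contra hne
        exact disjoint_left.1 (hdisj (fun h => hne (Nat.succ_injective h) : k + 1 ≠ l + 1))
          (hΦW k a hk) (hab ▸ hΦW l b hl)
      subst hkl
      rw [hΦ k a hk, hΦ k b hl] at hab
      exact hψi k hk hl hab
    · obtain ⟨k, hk⟩ := ha
      rw [hΦ' b (not_exists.1 hb)] at hab
      exact absurd ⟨k + 1, hab ▸ hΦW k a hk⟩ hb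
    · obtain ⟨k, hk⟩ := hb
      rw [hΦ' a (not_exists.1 ha)] at hab
      exact absurd ⟨k + 1, hab ▸ hΦW k b hk⟩ ha
    · rwa [hΦ' a (not_exists.1 ha), hΦ' b (not_exists.1 hb)] at hab
  · refine Subset.antisymm ?_ fun y hy => ?_
    · rintro _ ⟨a, -, rfl⟩
      by_cases ha : ∃ k, a ∈ W k
      · obtain ⟨k, hk⟩ := ha
        exact disjoint_left.1 (hdisj (Nat.succ_ne_zero k)) (hΦW k a hk)
      · rw [hΦ' a (not_exists.1 ha)]
        exact fun h => ha ⟨0, h⟩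
    · by_cases h : ∃ k, y ∈ W k
      · obtain ⟨k, hk⟩ := h
        cases k with
        | zero => exact absurd hk hy
        | succ k =>
          obtain ⟨a, ha, rfl⟩ := (hψW k).symm ▸ hk
          exact ⟨a, mem_univ a, hΦ k a ha⟩
      · exact ⟨y, mem_univ y, hΦ' y (not_exists.1 h)⟩
  · intro a _
    by_cases ha : ∃ k, a ∈ W k
    · obtain ⟨k, hk⟩ := ha
      rw [hΦ k a hk]
      exact hψG k a hk
    · rw [hΦ' a (not_exists.1 ha)]

/-- Disjoint copies of `Aᶜ` are chosen in neighbourhoods of `x` that shrink to `x` and avoid the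
earlier copies. With `Aᶜ` itself put in front, the shift identifies the whole space with `A`. -/
theorem hasCopyIn_univ_of_copies [TotallyDisconnectedSpace E] [SecondCountableTopology E]
    {A : Set E} (hA : IsClopen A) (hxA : x ∈ A) (h : ∀ S, IsClopen S → x ∈ S → S ⊆ A → ∃ W, IsClopen W ∧ W ⊆ S ∧ x ∉ W ∧
      PairHomeo G Aᶜ W) : HasCopyIn G univ A := by
  obtain ⟨N, hN⟩ := (nhds x).exists_antitone_basis
  choose D hD hxD hDN using fun n => compact_exists_isClopen_in_isOpen (x := x) isOpen_interior
    (mem_interior_iff_mem_nhds.2 (hN.1.mem_of_mem (i := n) trivial))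
  let T := {S : Set E // IsClopen S ∧ x ∈ S ∧ S ⊆ A}
  choose W hW hWS hxW hWA using fun S : T => h S.1 S.2.1 S.2.2.1 S.2.2.2
  let next : T → ℕ → T := fun S n => ⟨(S.1 ∩ D n) \ W S, (S.2.1.inter (hD n)).diff (hW S),
    ⟨⟨S.2.2.1, hxD n⟩, hxW S⟩, fun _ ha => S.2.2.2 ha.1.1⟩
  let S : ℕ → T := fun n => Nat.rec ⟨A, hA, hxA, Subset.rfl⟩ (fun n S => next S n) n
  have hS : ∀ n, S (n + 1) = next (S n) n := fun n => rfl
  have hanti : Antitone fun n => (S n).1 :=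
    antitone_nat_of_succ_le fun n a ha => ha.1.1
  let V : ℕ → Set E := fun n => Nat.casesOn n Aᶜ fun n => W (S n)
  have hV : ∀ n, IsClopen (V n) := by
    rintro (_ | n)
    · exact hA.compl
    · exact hW _
  have hlt : ∀ i j, i < j → Disjoint (V i) (V j) := by
    rintro (_ | i) (_ | j) hij
    · omega
    · exact disjoint_left.2 fun a ha haj => ha ((S j).2.2.2 (hWS _ haj))
    · omega
    · refine disjoint_left.2 fun a ha haj => ?_
      exact (hanti (show i + 1 ≤ j by omega) (hWS _ haj)).2 ha
  have hVA : ∀ n, PairHomeo G Aᶜ (V n) := by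
    rintro (_ | n)
    · exact PairHomeo.refl G _
    · exact hWA _
  have hshift : PairHomeo G univ (V 0)ᶜ := by
    refine PairHomeo.univ_compl_of_seq (x := x) hV (fun i j hij => ?_)
      (fun k => (hVA k).symm.trans (hVA (k + 1))) ?_ ?_
    · rcases hij.lt_or_gt with h | h
      · exact hlt i j h
      · exact (hlt j i h).symm
    · rintro (_ | n)
      · exact fun h => h hxA
      · exact hxW _
    · intro U hU
      obtain ⟨n, -, hn⟩ := hN.1.mem_iff.1 hU
      -- One index is lost because `V 0` is `Aᶜ`, and one because `D n` first cuts down `S (n + 1)`.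
      refine ⟨n + 2, ?_⟩
      rintro (_ | k) hk
      · omega
      · intro a ha
        exact hn (interior_subset (hDN n (hanti (show n + 1 ≤ k by omega) (hWS _ ha)).1.2))
  rw [show (V 0)ᶜ = A from compl_compl A] at hshift
  exact ⟨A, hA, Subset.rfl, hshift⟩

end Shift

/-! ### Self-similarity from covers by two small pieces. -/

section Covers

variable {E : Type*} [TopologicalSpace E] {G A : Set E} {x : E}

/-- For every choice of neighbourhoods, the space is covered by a small clopen set and the image of
a small clopen set under a homeomorphism of the pair. -/
def HasHomeoCovers (G : Set E) : Prop :=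
  ∀ U : E → Set E, (∀ e, U e ∈ nhds e) → ∃ (h : E ≃ₜ E) (C C' : Set E),
    (∀ e, e ∈ G ↔ h e ∈ G) ∧ IsClopen C ∧ IsClopen C' ∧ (∃ e, C ⊆ U e) ∧ (∃ e, C' ⊆ U e) ∧
      ∀ e, e ∈ C ∨ e ∈ h '' C'

theorem selfSimilar_of_hasCopyIn (h : ∀ (n : ℕ) (P : Fin (n + 1) → Set E), (∀ i, IsClopen (P i)) →
    ⋃ i, P i = univ → ∃ i, HasCopyIn G univ (P i)) : SelfSimilar G := by
  intro n P hP _ hU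
  obtain ⟨i, W, hW, hWP, hEW⟩ := h n P hP hU
  exact ⟨W, hW, ⟨i, hWP⟩, hEW.symm⟩

variable [CompactSpace E] [T2Space E]

/-- A point `b` sent to `x` would have neighbourhoods that are copies of neighbourhoods of `x`. It
would then be above `x`, hence maximal, hence equal to `x`. -/
theorem ne_of_maximalPoints_eq_singleton (hM : maximalPoints G = {x}) {B : Set E}
    (hB : IsClopen B) (hxB : x ∉ B) {f : E → E} (hc : ContinuousOn f B) (hi : InjOn f B)
    (hcl : IsClopen (f '' B)) (hG : ∀ b ∈ B, (b ∈ G ↔ f b ∈ G)) : ∀ b ∈ B, f b ≠ x := by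
  intro b hb hfb
  have hxb : Below G x b := by
    refine below_iff.2 fun U hU hbU => ?_
    have hUB : IsClopen (U ∩ B) := hU.inter hB
    refine ⟨f '' (U ∩ B), isClopen_image hB hUB inter_subset_right hc hi hcl,
      ⟨b, ⟨hbU, hb⟩, hfb⟩, U ∩ B, hUB, inter_subset_left, PairHomeo.symm ?_⟩
    exact (pairHomeo_iff hUB.isClosed.isCompact).2 ⟨f, hc.mono inter_subset_right,
      hi.mono inter_subset_right, rfl, fun a ha => hG a ha.2⟩
  have hxM : x ∈ maximalPoints G := hM ▸ rfl
  have hbM : b ∈ maximalPoints G := fun y hy => (hxM y (hxb.trans hy)).trans hxb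
  rw [hM, mem_singleton_iff] at hbM
  exact hxB (hbM ▸ hb)

variable [TotallyDisconnectedSpace E]

/-- By pigeonhole one piece contains two maximal points, and every point is below both. Small sets
thus embed near either one; the two halves `C` and `Cᶜ` of the space go to disjoint neighbourhoods.
-/
theorem HasHomeoCovers.selfSimilar_of_infinite (hcov : HasHomeoCovers G)
    (hinf : (maximalPoints G).Infinite)
    (hsame : ∀ x ∈ maximalPoints G, ∀ y ∈ maximalPoints G, SameType G x y) : SelfSimilar G := by
  refine selfSimilar_of_hasCopyIn fun n P hP hPU => ?_
  obtain ⟨i, hi⟩ : ∃ i, (P i ∩ maximalPoints G).Infinite := by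
    by_contra! hfin
    refine hinf ((finite_iUnion fun i => hfin i).subset fun y hy => ?_)
    obtain ⟨i, hi⟩ := mem_iUnion.1 (hPU.symm ▸ mem_univ y)
    exact mem_iUnion.2 ⟨i, hi, hy⟩
  obtain ⟨x, hx, y, hy, hxy⟩ := hi.nontrivial
  obtain ⟨N, hN, hxN, hNy⟩ := compact_exists_isClopen_in_isOpen isOpen_ne hxy
  have hbelow : ∀ e, ∀ z ∈ maximalPoints G, Below G e z := by
    intro e z hz
    obtain ⟨m, hm, hem⟩ := exists_maximal_above G e
    exact hem.trans (hsame m hm z hz).1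
  choose V₁ hV₁ he₁ hc₁ using fun e =>
    below_iff.1 (hbelow e x hx.2) (P i ∩ N) ((hP i).inter hN) ⟨hx.1, hxN⟩
  choose V₂ hV₂ he₂ hc₂ using fun e =>
    below_iff.1 (hbelow e y hy.2) (P i \ N) ((hP i).diff hN) ⟨hy.1, fun h => hNy h rfl⟩
  obtain ⟨h, C, C', hG, hC, hC', ⟨e, he⟩, ⟨e', he'⟩, hCC⟩ := hcov (fun e => V₁ e ∩ V₂ e)
    fun e => ((hV₁ e).inter (hV₂ e)).isOpen.mem_nhds ⟨he₁ e, he₂ e⟩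
  refine ⟨i, ?_⟩
  rw [← union_compl_self C, ← inter_union_sdiff (P i) N]
  refine HasCopyIn.union hC hC.compl disjoint_compl_right (disjoint_sdiff_right.mono_left
    inter_subset_right) ?_ ?_
  · exact (hc₁ e).mono_left (hV₁ e) hC (he.trans inter_subset_left)
  · refine HasCopyIn.trans hC.compl (hV₂ e') ?_ (hc₂ e')
    refine HasCopyIn.of_homeomorph hC.compl h.symm (fun a => by simpa using (hG (h.symm a)).symm) ?_
    rintro _ ⟨a, ha, rfl⟩
    obtain ⟨b, hb, rfl⟩ := (hCC a).resolve_left ha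
    rw [h.symm_apply_apply]
    exact (he' hb).2

/-- Every homeomorphism of the pair fixes `x`, so in the cover `C ∪ h(C')` one of `C`, `C'` contains
`x` and therefore lies in `A`. Then `h⁻¹` or `h` carries `Aᶜ` into the other set, which is small
enough to embed in `A`. -/
theorem hasCopyIn_compl_of_maximalPoints_eq_singleton
    (hcov : (∃ e₁ e₂ e₃ : E, e₁ ≠ e₂ ∧ e₁ ≠ e₃ ∧ e₂ ≠ e₃) → HasHomeoCovers G)
    (hM : maximalPoints G = {x}) (hA : IsClopen A) (hxA : x ∈ A) : HasCopyIn G Aᶜ A := by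
  classical
  have hbelow : ∀ e, Below G e x := by
    intro e
    obtain ⟨m, hm, hem⟩ := exists_maximal_above G e
    rw [hM, mem_singleton_iff] at hm
    exact hm ▸ hem
  choose V hV heV hcV using fun e => below_iff.1 (hbelow e) A hA hxA
  rcases (Aᶜ).eq_empty_or_nonempty with hempty | ⟨y, hy⟩
  · rw [hempty]
    exact HasCopyIn.refl isClopen_empty (empty_subset A)
  -- A point `y` outside `A` has a copy in `A` different from `x`, so the covering property is
  -- available.
  have hthree : ∃ e₁ e₂ e₃ : E, e₁ ≠ e₂ ∧ e₁ ≠ e₃ ∧ e₂ ≠ e₃ := by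
    have hB := (hV y).inter hA.compl
    obtain ⟨f, hc, hi, hm, hcl, hG⟩ := (hasCopyIn_iff hB).1
      ((hcV y).mono_left (hV y) hB inter_subset_left)
    have hyB : y ∈ V y ∩ Aᶜ := ⟨heV y, hy⟩
    exact ⟨f y, x, y, ne_of_maximalPoints_eq_singleton hM hB (fun h => h.2 hxA) hc hi hcl hG y hyB,
      fun h => hy (h ▸ hm hyB), fun h => hy (h ▸ hxA)⟩
  -- All these sets embed in `A`, and the only one containing `x` is `A` itself.
  let U : E → Set E := fun e => if e ∈ A then A else V e ∩ Aᶜ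
  have hUpos : ∀ e, e ∈ A → U e = A := fun e he => if_pos he
  have hUneg : ∀ e, e ∉ A → U e = V e ∩ Aᶜ := fun e he => if_neg he
  have hU : ∀ e, IsClopen (U e) ∧ e ∈ U e ∧ HasCopyIn G (U e) A := by
    intro e
    by_cases he : e ∈ A
    · rw [hUpos e he]
      exact ⟨hA, he, HasCopyIn.refl hA Subset.rfl⟩
    · rw [hUneg e he]
      have hB := (hV e).inter hA.compl
      exact ⟨hB, ⟨heV e, he⟩, (hcV e).mono_left (hV e) hB inter_subset_left⟩
  obtain ⟨h, C, C', hG, -, -, ⟨e, he⟩, ⟨e', he'⟩, hCC⟩ := hcov hthree U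
    fun e => (hU e).1.isOpen.mem_nhds (hU e).2.1
  by_cases heA : e ∈ A
  · rw [hUpos e heA] at he
    refine HasCopyIn.trans hA.compl (hU e').1 ?_ (hU e').2.2
    refine HasCopyIn.of_homeomorph hA.compl h.symm
      (fun a => by simpa using (hG (h.symm a)).symm) ?_
    rintro _ ⟨a, ha, rfl⟩
    obtain ⟨b, hb, rfl⟩ := (hCC a).resolve_left fun h => ha (he h)
    rw [h.symm_apply_apply]
    exact he' hb
  · have hxC : x ∉ C := fun h => (hUneg e heA ▸ he h : x ∈ V e ∩ Aᶜ).2 hxA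
    obtain ⟨c, hc, hcx⟩ := (hCC x).resolve_left hxC
    have hcx' : c = x := by
      by_contra hne
      obtain ⟨B, hB, hcB, hBx⟩ := compact_exists_isClopen_in_isOpen isOpen_ne hne
      exact ne_of_maximalPoints_eq_singleton hM hB (fun h => hBx h rfl)
        h.continuous.continuousOn h.injective.injOn
        ⟨h.isClosed_image.2 hB.isClosed, h.isOpen_image.2 hB.isOpen⟩ (fun b _ => hG b) c hcB hcx
    rw [hcx'] at hc
    have heA' : e' ∈ A := by
      by_contra hne
      exact (hUneg e' hne ▸ he' hc : x ∈ V e' ∩ Aᶜ).2 hxA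
    rw [hUpos e' heA'] at he'
    refine HasCopyIn.trans hA.compl (hU e).1 ?_ (hU e).2.2
    refine HasCopyIn.of_homeomorph hA.compl h hG ?_
    rintro _ ⟨a, ha, rfl⟩
    refine he ((hCC (h a)).resolve_right ?_)
    rintro ⟨b, hb, hba⟩
    exact ha (h.injective hba ▸ he' hb)

theorem selfSimilar_of_maximalPoints_eq_singleton [SecondCountableTopology E]
    (hcov : (∃ e₁ e₂ e₃ : E, e₁ ≠ e₂ ∧ e₁ ≠ e₃ ∧ e₂ ≠ e₃) → HasHomeoCovers G)
    (hM : maximalPoints G = {x}) : SelfSimilar G := by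
  refine selfSimilar_of_hasCopyIn fun n P hP hPU => ?_
  obtain ⟨i, hi⟩ := mem_iUnion.1 (hPU.symm ▸ mem_univ x)
  refine ⟨i, hasCopyIn_univ_of_copies (hP i) hi fun S hS hxS hSP => ?_⟩
  have hcopy := (hasCopyIn_compl_of_maximalPoints_eq_singleton hcov hM hS hxS).mono_left hS.compl
    (hP i).compl (compl_subset_compl.2 hSP)
  obtain ⟨f, hc, hinj, hm, hcl, hG⟩ := (hasCopyIn_iff (hP i).compl).1 hcopy
  refine ⟨f '' (P i)ᶜ, hcl, hm.image_subset, ?_,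
    (pairHomeo_iff (hP i).compl.isClosed.isCompact).2 ⟨f, hc, hinj, rfl, hG⟩⟩
  rintro ⟨b, hb, hbx⟩
  exact ne_of_maximalPoints_eq_singleton hM (hP i).compl (fun h => h hi) hc hinj hcl hG b hb hbx

/-- The covering property is assumed only for three or more points: a Cantor set of maximal points
supplies them, and the singleton case produces them when needed. -/
theorem selfSimilar_iff [SecondCountableTopology E] [Nonempty E]
    (hcov : (∃ e₁ e₂ e₃ : E, e₁ ≠ e₂ ∧ e₁ ≠ e₃ ∧ e₂ ≠ e₃) → HasHomeoCovers G) :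
    SelfSimilar G ↔ ((∃ x, maximalPoints G = {x}) ∨ (IsCantorSet (maximalPoints G) ∧
      ∀ x ∈ maximalPoints G, ∀ y ∈ maximalPoints G, SameType G x y)) := by
  classical
  refine ⟨fun h => h.maximalPoints_singleton_or_cantor, ?_⟩
  rintro (⟨x, hM⟩ | ⟨⟨φ⟩, hsame⟩)
  · exact selfSimilar_of_maximalPoints_eq_singleton hcov hM
  · have hinf : (maximalPoints G).Infinite := by
      rw [← infinite_coe_iff]
      exact Infinite.of_injective φ.symm φ.symm.injective
    refine (hcov ?_).selfSimilar_of_infinite hinf hsame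
    obtain ⟨t, -, ht⟩ := hinf.exists_subset_card_eq 3
    obtain ⟨a, b, c, hab, hac, hbc, -⟩ := Finset.card_eq_three.1 ht
    exact ⟨a, b, c, hab, hac, hbc⟩

end Covers

end Surf

theorem mainTheorem9 (X : Type*) [TopologicalSpace X]
    (hX : Surf.IsOrientableSurface X) (hdisp : Surf.NoNondisplaceableSubsurface X) :
    Surf.SelfSimilar (Surf.genusEnds X) ↔
      ((∃ x, Surf.maximalPoints (Surf.genusEnds X) = {x}) ∨
        (Surf.IsCantorSet (Surf.maximalPoints (Surf.genusEnds X)) ∧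
          ∀ x ∈ Surf.maximalPoints (Surf.genusEnds X),
            ∀ y ∈ Surf.maximalPoints (Surf.genusEnds X),
              Surf.SameType (Surf.genusEnds X) x y)) := by
  obtain ⟨_, _, _, _, _, _⟩ := hX
  have := Surf.noncompactSpace_of_noNondisplaceable hdisp
  have : Nonempty (Surf.EndSpace X) := Surf.EndSpace.nonempty_of_noncompactSpace
  refine Surf.selfSimilar_iff ?_
  rintro ⟨e₁, e₂, e₃, h12, h13, h23⟩ U hU
  exact Surf.exists_homeo_cover_of_noNondisplaceable hdisp h12 h13 h23 hU
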